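/- An inversion sequence of length $n$ is a sequence $e=e_1\cdots e_n$ of integers with $0\le e_i<i$ for all $i$. Two integer sequences $\pi_1\cdots\pi_k$ and $\sigma_1\cdots\sigma_k$ are order isomorphic if for all $i,j$ the entries $\pi_i,\pi_j$ and the entries $\sigma_i,\sigma_j$ are in the same relation $<$, $=$ or $>$. A pattern of length $k$ is an integer sequence $\pi=\pi_1\cdots\pi_k$; an inversion sequence avoids $\pi$ if none of its (not necessarily consecutive) subsequences of length $k$ is order isomorphic to $\pi$. Let $\mathbf I_n(\pi)$ be the set of inversion sequences of length $n$ that avoid $\pi$, and call $\pi$ and $\sigma$ Wilf equivalent, $\pi\equiv\sigma$, if $|\mathbf I_n(\pi)|=|\mathbf I_n(\sigma)|$ for all $n\ge 1$. Then the following Wilf equivalences hold: $$1011\equiv1101\equiv1110,\quad 2110\equiv2101\equiv2011,\quad 0221\equiv0212,\quad 0312\equiv0321,$$ $$1102\equiv1012,\quad 2201\equiv2210,\quad 2301\equiv2310,\quad 3201\equiv3210.$$ Moreover, up to order isomorphism there are no other Wilf equivalences between distinct patterns of length 4, except possibly $3201\equiv3210\equiv3012$: if $\pi,\sigma$ are patterns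 of length 4 with $\pi\equiv\sigma$, then $\pi$ and $\sigma$ are order isomorphic to each other, or both are order isomorphic to members of one and the same of the sets $\{1011,1101,1110\}$, $\{2110,2101,2011\}$, $\{0221,0212\}$, $\{0312,0321\}$, $\{1102,1012\}$, $\{2201,2210\}$, $\{2301,2310\}$, $\{3201,3210,3012\}$. (Whether $3012$ is Wilf equivalent to $3201$ is not asserted either way.) -/

import Mathlib

/-- A sequence `e` of length `n` (indexed from `0`) is an inversion sequence if its entry in
(1-indexed) position `i` satisfies `0 ≤ e_i < i`. -/
def IsInversionSequence {n : ℕ} (e : Fin n → ℕ) : Prop :=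
  ∀ i : Fin n, e i < (i : ℕ) + 1

/-- Two sequences of the same length are order isomorphic if any two positions carry the same
relation `<`, `=` or `>` in both of them. -/
def OrderIsomorphic {k : ℕ} {α β : Type} [LinearOrder α] [LinearOrder β]
    (π : Fin k → α) (σ : Fin k → β) : Prop :=
  ∀ i j : Fin k,
    (π i < π j ↔ σ i < σ j) ∧ (π i = π j ↔ σ i = σ j) ∧ (π i > π j ↔ σ i > σ j)

/-- `e` contains the pattern `π` if some (not necessarily consecutive) subsequence of `e` is
order isomorphic to `π`. The positions of the subsequence are given by a strictly increasing
map. -/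
def ContainsPattern {n k : ℕ} (e : Fin n → ℕ) (π : Fin k → ℤ) : Prop :=
  ∃ s : Fin k → Fin n, StrictMono s ∧ OrderIsomorphic (fun i => e (s i)) π

/-- The inversion sequences of length `n` that avoid `π`. -/
def avoidanceClass (n : ℕ) {k : ℕ} (π : Fin k → ℤ) : Set (Fin n → ℕ) :=
  {e | IsInversionSequence e ∧ ¬ ContainsPattern e π}

/-- The avoidance class is finite, so that its `Set.ncard` is its cardinality. -/
theorem avoidanceClass_finite (n : ℕ) {k : ℕ} (π : Fin k → ℤ) :
    (avoidanceClass n π).Finite :=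
  (Set.finite_Iic (fun i : Fin n => (i : ℕ))).subset
    fun _ he i => Nat.lt_succ_iff.mp (he.1 i)

/-- Wilf equivalence of patterns over inversion sequences. -/
def WilfEquivalent {k l : ℕ} (π : Fin k → ℤ) (σ : Fin l → ℤ) : Prop :=
  ∀ n : ℕ, 1 ≤ n → (avoidanceClass n π).ncard = (avoidanceClass n σ).ncard

/-! Equivalences. An inversion sequence is a filling of a staircase with one cell in each column,
and it can be built row by row from the largest value down. Fix a row `v` and mark each column that
is still open there with `true` if its entry is `v` and with `false` if its entry is smaller. In
each asserted equivalence, up to a leading 0, the letters of the pattern that are larger than two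
adjacent values single out a zone of columns, and the pattern occurs iff in some row the marks along
the open columns of the zone contain a fixed binary word. For 2110, 2101 and 2011 the zone lies to
the right of a larger entry, and the words are 110, 101 and 011.

Two facts allow the letters of that word to be permuted. The number of binary words of given length
and given number of ones that avoid a subsequence depends only on the multiset of its letters
(`subwordFreeSum_perm`). And what can happen in the lower rows depends on how many columns of the
zone were used, not on which ones, because every open column of the zone also meets all lower rows
(`Interchangeable.card_completions_eq`). A leading 0 costs nothing: the first entry is always 0, so
one fixes the positions of all zeros and fills the other columns with positive entries
(`PositiveRowDetects.wilfEquivalent`).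

Non-equivalences. There are 75 patterns up to order isomorphism, and their avoidance numbers at
lengths 7 to 10 separate all those not claimed or allowed to be equivalent (`count_patternTable`,
`eq_or_mem_patternClasses`). The numbers come from a verified dynamic program: a prefix matters only
through the letters, pairs and triples that it forbids in the remainder, so prefixes with equal data
are merged. -/

/-! ### Counting words that avoid a set of subsequences

A set of forbidden words of length `k` over the alphabet `{0, …, n - 1}` is stored as a bit mask,
the word being read as a number in base `n`. -/

/-- Concatenation of the blocks `f 0, …, f (k - 1)` of `s` bits each. -/
def concatBits (s : ℕ) (f : ℕ → ℕ) (k : ℕ) : ℕ :=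
  Nat.rec 0 (fun i acc => Nat.lor acc (Nat.shiftLeft (f i) (i * s))) k

/-- The block number `v` of `s` bits of `g`. -/
def bitBlock (s g v : ℕ) : ℕ := Nat.mod (Nat.shiftRight g (v * s)) (2 ^ s)

theorem testBit_bitBlock {s g v j : ℕ} (hj : j < s) :
    (bitBlock s g v).testBit j = g.testBit (v * s + j) := by
  change ((g >>> (v * s)) % 2 ^ s).testBit j = _
  simp [Nat.testBit_mod_two_pow, hj]

theorem concatBits_succ (s : ℕ) (f : ℕ → ℕ) (k : ℕ) :
    concatBits s f (k + 1) = concatBits s f k ||| (f k <<< (k * s)) := rfl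

theorem concatBits_lt {s : ℕ} {f : ℕ → ℕ} (hf : ∀ i, f i < 2 ^ s) (k : ℕ) :
    concatBits s f k < 2 ^ (k * s) := by
  induction k with
  | zero => simp [concatBits]
  | succ k ih =>
    rw [concatBits_succ]
    apply Nat.or_lt_two_pow
    · exact ih.trans_le (Nat.pow_le_pow_right (by norm_num) (by gcongr; simp))
    · rw [Nat.shiftLeft_eq, add_mul, one_mul, add_comm, pow_add]
      exact Nat.mul_lt_mul_of_pos_right (hf k) (by positivity)

theorem testBit_concatBits {s : ℕ} {f : ℕ → ℕ} (hf : ∀ i, f i < 2 ^ s) {k i j : ℕ}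
    (hi : i < k) (hj : j < s) : (concatBits s f k).testBit (i * s + j) = (f i).testBit j := by
  induction k with
  | zero => omega
  | succ k ih =>
    rw [concatBits_succ, Nat.testBit_or, Nat.testBit_shiftLeft]
    rcases Nat.lt_succ_iff_lt_or_eq.mp hi with h | rfl
    · rw [ih h]
      have : ¬ (i * s + j ≥ k * s) := by
        have : (i + 1) * s ≤ k * s := Nat.mul_le_mul_right _ h
        rw [add_mul] at this
        omega
      simp [this]
    · have : (concatBits s f i).testBit (i * s + j) = false :=
        Nat.testBit_lt_two_pow ((concatBits_lt hf i).trans_le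
          (Nat.pow_le_pow_right (by norm_num) (by omega)))
      simp [this]

/-- Whether the pairs `a, b` and `x, y` are in the same relation `<`, `=` or `>`. -/
def sameOrder (a b x y : ℕ) : Bool :=
  (Nat.blt a b == Nat.blt x y) && (Nat.blt b a == Nat.blt y x)

theorem sameOrder_iff (a b x y : ℕ) :
    sameOrder a b x y = true ↔ ((a < b ↔ x < y) ∧ (b < a ↔ y < x)) := by
  have h : ∀ a b x y : ℕ, (Nat.blt a b == Nat.blt x y) = true ↔ (a < b ↔ x < y) := by
    intro a b x y
    rw [beq_iff_eq, Bool.eq_iff_iff, Nat.blt_eq, Nat.blt_eq]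
  rw [sameOrder, Bool.and_eq_true, h, h]

/-- A pattern of length four. -/
structure Pattern where
  /-- The first entry. -/
  a : ℕ
  /-- The second entry. -/
  b : ℕ
  /-- The third entry. -/
  c : ℕ
  /-- The fourth entry. -/
  d : ℕ

instance : DecidableEq Pattern := fun p q =>
  decidable_of_iff (p.a = q.a ∧ p.b = q.b ∧ p.c = q.c ∧ p.d = q.d) (by cases p; cases q; simp)

/-- The pattern as a sequence of integers. -/
def Pattern.seq (p : Pattern) : Fin 4 → ℤ := ![p.a, p.b, p.c, p.d]

/-- The mask of the words over `{0, …, n - 1}` that are order isomorphic to `p`. -/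
def Pattern.mask (p : Pattern) (n : ℕ) : ℕ :=
  concatBits (n * (n * n)) (fun a =>
    concatBits (n * n) (fun b => bif sameOrder p.a p.b a b then
      concatBits n (fun c => bif sameOrder p.a p.c a c && sameOrder p.b p.c b c then
        concatBits 1 (fun d => bif sameOrder p.a p.d a d && sameOrder p.b p.d b d &&
          sameOrder p.c p.d c d then 1 else 0) n else 0) n else 0) n) n

/-- The bounds make `a, b, c, d` the base-`n` digits of the code, so the nested blocks are read off
one digit at a time; a block whose prefix already disagrees with `p` is 0. -/
theorem Pattern.testBit_mask (p : Pattern) {n a b c d : ℕ} (ha : a < n) (hb : b < n) (hc : c < n)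
    (hd : d < n) : (p.mask n).testBit (a * (n * (n * n)) + (b * (n * n) + (c * n + d))) =
      (sameOrder p.a p.b a b && (sameOrder p.a p.c a c && sameOrder p.b p.c b c &&
        (sameOrder p.a p.d a d && sameOrder p.b p.d b d && sameOrder p.c p.d c d))) := by
  have two (u v s : ℕ) (hu : u < n) (hv : v < s) : u * s + v < n * s := by
    have : (u + 1) * s ≤ n * s := Nat.mul_le_mul_right _ hu
    rw [add_mul] at this
    omega
  have h2 := two c d n hc hd
  have h3 := two b _ _ hb h2
  have cond_lt {B : Bool} {x s : ℕ} (hx : x < 2 ^ s) : (bif B then x else 0) < 2 ^ s := by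
    cases B
    · simp
    · simpa using hx
  have lt1 : ∀ B : Bool, (bif B then 1 else 0) < 2 ^ 1 := fun B => cond_lt (by norm_num)
  have lt2 (f : ℕ → Bool) : concatBits 1 (fun d => bif f d then 1 else 0) n < 2 ^ n := by
    simpa using concatBits_lt (s := 1) (f := fun d => bif f d then 1 else 0) (fun d => lt1 _) n
  rw [Pattern.mask, testBit_concatBits (fun _ => concatBits_lt (fun _ => cond_lt
    (concatBits_lt (fun _ => cond_lt (lt2 _)) n)) n) ha h3,
    testBit_concatBits (fun _ => cond_lt (concatBits_lt (fun _ => cond_lt (lt2 _)) n)) hb h2]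
  cases sameOrder p.a p.b a b
  · simp
  simp only [cond_true, Bool.true_and]
  rw [testBit_concatBits (fun _ => cond_lt (lt2 _)) hc hd]
  cases sameOrder p.a p.c a c && sameOrder p.b p.c b c
  · simp
  simp only [cond_true, Bool.true_and]
  have := testBit_concatBits (s := 1) (f := fun d => bif sameOrder p.a p.d a d &&
    sameOrder p.b p.d b d && sameOrder p.c p.d c d then 1 else 0) (fun d => lt1 _) hd zero_lt_one
  rw [mul_one, add_zero] at this
  rw [this]
  cases sameOrder p.a p.d a d && sameOrder p.b p.d b d && sameOrder p.c p.d c d <;> simp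

/-- The word `w` has no entry in the mask `x`, and no subsequence of length two, three or four
in the mask `y`, `z` or `q`. -/
def AvoidsMasks (n q x y z : ℕ) {r : ℕ} (w : Fin r → ℕ) : Prop :=
  (∀ i, x.testBit (w i) = false) ∧
  (∀ i j, i < j → y.testBit (w i * n + w j) = false) ∧
  (∀ i j k, i < j → j < k → z.testBit (w i * (n * n) + (w j * n + w k)) = false) ∧
  (∀ i j k l, i < j → j < k → k < l →
    q.testBit (w i * (n * (n * n)) + (w j * (n * n) + (w k * n + w l))) = false)

/-- A forbidden subsequence either misses the head `v` or starts with it; in the latter case its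
tail, one letter shorter, becomes forbidden in `w`. The tails of the codes starting with `v` are
block `v` of the mask, and `hw` keeps the codes inside that block. -/
theorem avoidsMasks_cons {n q x y z r v : ℕ} {w : Fin r → ℕ} (hw : ∀ i, w i < n) :
    AvoidsMasks n q x y z (Fin.cons v w : Fin (r + 1) → ℕ) ↔
      x.testBit v = false ∧ AvoidsMasks n q (x ||| bitBlock n y v)
        (y ||| bitBlock (n * n) z v) (z ||| bitBlock (n * (n * n)) q v) w := by
  have two (u v s : ℕ) (hu : u < n) (hv : v < s) : u * s + v < n * s := by
    have : (u + 1) * s ≤ n * s := Nat.mul_le_mul_right _ hu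
    rw [add_mul] at this
    omega
  have e1 (i) : (bitBlock n y v).testBit (w i) = y.testBit (v * n + w i) :=
    testBit_bitBlock (hw i)
  have e2 (i j) : (bitBlock (n * n) z v).testBit (w i * n + w j) =
      z.testBit (v * (n * n) + (w i * n + w j)) :=
    testBit_bitBlock (two _ _ _ (hw i) (hw j))
  have e3 (i j k) : (bitBlock (n * (n * n)) q v).testBit (w i * (n * n) + (w j * n + w k)) =
      q.testBit (v * (n * (n * n)) + (w i * (n * n) + (w j * n + w k))) :=
    testBit_bitBlock (two _ _ _ (hw i) (two _ _ _ (hw j) (hw k)))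
  simp only [AvoidsMasks, Fin.forall_fin_succ, Fin.cons_zero, Fin.cons_succ, Nat.testBit_or,
    Bool.or_eq_false_iff, e1, e2, e3, Fin.succ_lt_succ_iff, Fin.succ_pos, Fin.not_lt_zero,
    false_imp_iff, true_imp_iff, imp_true_iff, true_and, forall_and]
  tauto

open Classical in
/-- The words `w` of length `r` with `w i ≤ m + i` that avoid the masks. -/
noncomputable def maskWords (n q m r x y z : ℕ) : Finset (Fin r → ℕ) :=
  (Fintype.piFinset fun i : Fin r => Finset.range (m + i + 1)).filter (AvoidsMasks n q x y z)

theorem mem_maskWords {n q m r x y z : ℕ} {w : Fin r → ℕ} :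
    w ∈ maskWords n q m r x y z ↔ (∀ i : Fin r, w i < m + i + 1) ∧ AvoidsMasks n q x y z w := by
  simp [maskWords]

theorem card_maskWords_succ {n q m r x y z : ℕ} (h : m + (r + 1) ≤ n) :
    (maskWords n q m (r + 1) x y z).card = ∑ v ∈ Finset.range (m + 1),
      bif x.testBit v then 0 else (maskWords n q (m + 1) r (x ||| bitBlock n y v)
        (y ||| bitBlock (n * n) z v) (z ||| bitBlock (n * (n * n)) q v)).card := by
  have key (v : ℕ) (w : Fin r → ℕ) : (Fin.cons v w : Fin (r + 1) → ℕ) ∈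
      maskWords n q m (r + 1) x y z ↔ v < m + 1 ∧ x.testBit v = false ∧
        w ∈ maskWords n q (m + 1) r (x ||| bitBlock n y v)
          (y ||| bitBlock (n * n) z v) (z ||| bitBlock (n * (n * n)) q v) := by
    have e : (∀ i : Fin (r + 1), (Fin.cons v w : Fin (r + 1) → ℕ) i < m + i + 1) ↔
        v < m + 1 ∧ ∀ i : Fin r, w i < m + 1 + i + 1 := by
      rw [Fin.forall_fin_succ]
      refine and_congr (by simp) (forall_congr' fun i => ?_)
      rw [Fin.cons_succ, Fin.val_succ, show m + (i + 1) = m + 1 + (i : ℕ) by omega]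
    rw [mem_maskWords, mem_maskWords, e, and_assoc]
    refine and_congr_right fun _ => ?_
    by_cases hw : ∀ i : Fin r, w i < m + 1 + i + 1
    · rw [avoidsMasks_cons fun i => (hw i).trans_le (by omega)]
      simp [hw]
    · exact ⟨fun h => absurd h.1 hw, fun h => absurd h.2.1 hw⟩
  rw [Finset.card_eq_sum_card_fiberwise (f := fun w => w 0) (t := Finset.range (m + 1))]
  · refine Finset.sum_congr rfl fun v hv => ?_
    have hv' := Finset.mem_range.mp hv
    cases hx : x.testBit v
    · simp only [cond_false]
      refine Finset.card_nbij' Fin.tail (fun w => Fin.cons v w) ?_ ?_ ?_ ?_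
      · intro w hw
        simp only [Finset.coe_filter, Set.mem_ofPred_eq] at hw
        obtain ⟨hw, rfl⟩ := hw
        rw [← Fin.cons_self_tail w] at hw
        exact ((key _ _).1 hw).2.2
      · intro w hw
        simp only [Finset.coe_filter, Set.mem_ofPred_eq]
        exact ⟨(key _ _).2 ⟨hv', hx, hw⟩, rfl⟩
      · intro w hw
        simp only [Finset.coe_filter, Set.mem_ofPred_eq] at hw
        obtain ⟨hw, rfl⟩ := hw
        exact Fin.cons_self_tail w
      · intro w hw
        simp
    · simp only [cond_true, Finset.card_eq_zero, Finset.filter_eq_empty_iff]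
      rintro w hw rfl
      rw [← Fin.cons_self_tail w] at hw
      simpa [hx] using ((key _ _).1 hw).2.1
  · intro w hw
    have hw : w ∈ maskWords n q m (r + 1) x y z := hw
    rw [← Fin.cons_self_tail w] at hw
    simpa using ((key _ _).1 hw).1

/-- A word of length `r` has no subsequence longer than `r`, so the masks of longer words can be
cleared. This makes more states coincide near the end of the word. -/
theorem card_maskWords_truncate (n q m r x y z : ℕ) :
    (maskWords n q m r (bif Nat.ble r 0 then 0 else x) (bif Nat.ble r 1 then 0 else y)
      (bif Nat.ble r 2 then 0 else z)).card = (maskWords n q m r x y z).card := by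
  congr 1
  ext w
  simp only [mem_maskWords]
  refine and_congr_right fun _ => ?_
  match r, w with
  | 0, w => simp [AvoidsMasks]
  | 1, w => simp [AvoidsMasks, Nat.ble]
  | 2, w => simp [AvoidsMasks, Fin.forall_fin_two, Nat.ble]
  | r + 3, w => simp [Nat.ble]

/-! ### Merging equal states: the dynamic program and its correctness -/

/-- Evaluation of `x` to a numeral before it is passed on, for the benefit of kernel reduction. -/
def force {α : Type} (x : ℕ) (k : ℕ → α) : α := Nat.rec (k 0) (fun m _ => k (m + 1)) x

theorem force_eq {α : Type} (x : ℕ) (k : ℕ → α) : force x k = k x := by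
  cases x <;> rfl

/-- A binary search tree of triples of masks with multiplicities. -/
inductive MaskTree
  | leaf : MaskTree
  | node : ℕ → ℕ → ℕ → ℕ → MaskTree → MaskTree → MaskTree

namespace MaskTree

/-- Insertion of a triple with a multiplicity. -/
noncomputable def insert (x y z m : ℕ) (t : MaskTree) : MaskTree :=
  MaskTree.rec (.node x y z m .leaf .leaf)
    (fun x' y' z' m' l r il ir =>
      bif Nat.beq x x' && (Nat.beq y y' && Nat.beq z z') then
        force (m' + m) fun s => .node x' y' z' s l r
      else bif Nat.blt (x + y + z) (x' + y' + z') then .node x' y' z' m' il r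
      else .node x' y' z' m' l ir) t

/-- The sum of a weight over the tree. -/
noncomputable def weight (f : ℕ → ℕ → ℕ → ℕ) (t : MaskTree) : ℕ :=
  MaskTree.rec 0 (fun x y z m _ _ il ir => il + m * f x y z + ir) t

theorem weight_node (f : ℕ → ℕ → ℕ → ℕ) (x y z m : ℕ) (l r : MaskTree) :
    weight f (node x y z m l r) = weight f l + m * f x y z + weight f r := rfl

theorem weight_leaf (f : ℕ → ℕ → ℕ → ℕ) : weight f leaf = 0 := rfl

theorem insert_node (x y z m x' y' z' m' : ℕ) (l r : MaskTree) :
    insert x y z m (node x' y' z' m' l r) =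
      bif Nat.beq x x' && (Nat.beq y y' && Nat.beq z z') then
        force (m' + m) fun s => .node x' y' z' s l r
      else bif Nat.blt (x + y + z) (x' + y' + z') then .node x' y' z' m' (insert x y z m l) r
      else .node x' y' z' m' l (insert x y z m r) := rfl

/-- Holds for every tree, ordered or not: the comparison of sums only guides the search, and a
triple missed by it would merely be stored twice. -/
theorem weight_insert (f : ℕ → ℕ → ℕ → ℕ) (x y z m : ℕ) (t : MaskTree) :
    weight f (insert x y z m t) = weight f t + m * f x y z := by
  induction t with
  | leaf => simp [insert, weight]
  | node x' y' z' m' l r il ir =>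
    rw [insert_node]
    cases h : Nat.beq x x' && (Nat.beq y y' && Nat.beq z z')
    · cases Nat.blt (x + y + z) (x' + y' + z')
      · simp only [cond_false, weight_node, ir]
        ring
      · simp only [cond_false, cond_true, weight_node, il]
        ring
    · simp only [Bool.and_eq_true, Nat.beq_eq] at h
      obtain ⟨rfl, rfl, rfl⟩ := h
      simp only [cond_true, force_eq, weight_node]
      ring

/-- Insertion of the `k` first successors of a triple, the entry `v < k` of the word being read. -/
noncomputable def insertSucc (n q r x y z c : ℕ) (t : MaskTree) (k : ℕ) : MaskTree :=
  Nat.rec t (fun v acc => bif Nat.testBit x v then acc else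
    force (bif Nat.ble r 0 then 0 else Nat.lor x (bitBlock n y v)) fun x' =>
    force (bif Nat.ble r 1 then 0 else Nat.lor y (bitBlock (n * n) z v)) fun y' =>
    force (bif Nat.ble r 2 then 0 else Nat.lor z (bitBlock (n * (n * n)) q v)) fun z' =>
    acc.insert x' y' z' c) k

theorem insertSucc_succ (n q r x y z c : ℕ) (t : MaskTree) (k : ℕ) :
    insertSucc n q r x y z c t (k + 1) = bif Nat.testBit x k then insertSucc n q r x y z c t k else
      (insertSucc n q r x y z c t k).insert (bif Nat.ble r 0 then 0 else x ||| bitBlock n y k)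
        (bif Nat.ble r 1 then 0 else y ||| bitBlock (n * n) z k)
        (bif Nat.ble r 2 then 0 else z ||| bitBlock (n * (n * n)) q k) c := by
  simp only [insertSucc, force_eq]
  rfl

theorem weight_insertSucc (n q m r x y z c : ℕ) (t : MaskTree) (k : ℕ) :
    weight (fun x y z => (maskWords n q m r x y z).card) (insertSucc n q r x y z c t k) =
      weight (fun x y z => (maskWords n q m r x y z).card) t + c * ∑ v ∈ Finset.range k,
        bif x.testBit v then 0 else (maskWords n q m r (x ||| bitBlock n y v)
          (y ||| bitBlock (n * n) z v) (z ||| bitBlock (n * (n * n)) q v)).card := by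
  induction k with
  | zero => simp [insertSucc]
  | succ k ih =>
    rw [Finset.sum_range_succ, mul_add, ← add_assoc, ← ih]
    rw [insertSucc_succ]
    cases Nat.testBit x k
    · simp only [cond_false, weight_insert]
      rw [card_maskWords_truncate]
    · simp

/-- All triples that arise from those in `t` by reading one entry `v ≤ m`, added to a tree. -/
noncomputable def next (n q m r : ℕ) (t : MaskTree) : MaskTree → MaskTree :=
  MaskTree.rec (fun acc => acc)
    (fun x y z c _ _ fl fr acc => fr (insertSucc n q r x y z c (fl acc) (m + 1))) t

theorem weight_next {n q m r : ℕ} (h : m + (r + 1) ≤ n) (t acc : MaskTree) :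
    weight (fun x y z => (maskWords n q (m + 1) r x y z).card) (next n q m r t acc) =
      weight (fun x y z => (maskWords n q (m + 1) r x y z).card) acc +
        weight (fun x y z => (maskWords n q m (r + 1) x y z).card) t := by
  induction t generalizing acc with
  | leaf => rfl
  | node x y z c l r' il ir =>
    change weight _ (next n q m r r' (insertSucc n q r x y z c (next n q m r l acc) (m + 1))) = _
    rw [ir, weight_insertSucc, il, weight_node, card_maskWords_succ h]
    ring

/-- The triples reached after reading `k` entries. -/
noncomputable def reach (n q k : ℕ) : MaskTree :=
  Nat.rec (.node 0 0 0 1 .leaf .leaf) (fun m t => next n q m (n - (m + 1)) t .leaf) k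

/-- The invariant of the program: the prefixes of length `k`, each weighted by its number of
admissible continuations, always account for all words. -/
theorem weight_reach {n q k : ℕ} (hk : k ≤ n) :
    weight (fun x y z => (maskWords n q k (n - k) x y z).card) (reach n q k) =
      (maskWords n q 0 n 0 0 0).card := by
  induction k with
  | zero => simp [reach, weight]
  | succ k ih =>
    change weight _ (next n q k (n - (k + 1)) (reach n q k) .leaf) = _
    rw [weight_next (by omega), weight_leaf, zero_add, ← ih (by omega),
      show n - (k + 1) + 1 = n - k by omega]

end MaskTree

/-- The number of inversion sequences of length `n` that avoid `p`. -/
noncomputable def Pattern.count (p : Pattern) (n : ℕ) : ℕ :=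
  force (p.mask n) fun q => (MaskTree.reach n q n).weight fun _ _ _ => 1

theorem Pattern.count_eq_card (p : Pattern) (n : ℕ) :
    p.count n = (maskWords n (p.mask n) 0 n 0 0 0).card := by
  rw [Pattern.count, force_eq, ← MaskTree.weight_reach le_rfl]
  congr
  funext x y z
  -- With no letter left to read, the empty word is the only continuation, so every state has weight
  -- 1.
  rw [Nat.sub_self, eq_comm, Finset.card_eq_one]
  refine ⟨Fin.elim0, ?_⟩
  ext w
  simp [mem_maskWords, AvoidsMasks, Subsingleton.elim w Fin.elim0]

/-! ### Pattern avoidance as avoidance of a mask -/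

theorem containsPattern_iff {n : ℕ} (e : Fin n → ℕ) (π : Fin 4 → ℤ) :
    ContainsPattern e π ↔ ∃ i j k l, i < j ∧ j < k ∧ k < l ∧
      ((π 0 < π 1 ↔ e i < e j) ∧ (π 1 < π 0 ↔ e j < e i)) ∧
      ((π 0 < π 2 ↔ e i < e k) ∧ (π 2 < π 0 ↔ e k < e i)) ∧
      ((π 1 < π 2 ↔ e j < e k) ∧ (π 2 < π 1 ↔ e k < e j)) ∧
      ((π 0 < π 3 ↔ e i < e l) ∧ (π 3 < π 0 ↔ e l < e i)) ∧
      ((π 1 < π 3 ↔ e j < e l) ∧ (π 3 < π 1 ↔ e l < e j)) ∧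
      ((π 2 < π 3 ↔ e k < e l) ∧ (π 3 < π 2 ↔ e l < e k)) := by
  constructor
  · rintro ⟨s, hs, h⟩
    replace h := fun i j => (h i j).1.symm
    exact ⟨s 0, s 1, s 2, s 3, hs (by decide), hs (by decide), hs (by decide),
      ⟨h 0 1, h 1 0⟩, ⟨h 0 2, h 2 0⟩, ⟨h 1 2, h 2 1⟩, ⟨h 0 3, h 3 0⟩, ⟨h 1 3, h 3 1⟩,
      ⟨h 2 3, h 3 2⟩⟩
  · rintro ⟨i, j, k, l, hij, hjk, hkl, h⟩
    refine ⟨![i, j, k, l], ?_, ?_⟩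
    · rw [Fin.strictMono_iff_lt_succ]
      intro a
      fin_cases a <;> assumption
    · have key : ∀ a b : Fin 4, e (![i, j, k, l] a) < e (![i, j, k, l] b) ↔ π a < π b := by
        intro a b
        fin_cases a <;> fin_cases b <;> simp [h]
      intro a b
      refine ⟨key a b, ?_, key b a⟩
      rw [le_antisymm_iff, le_antisymm_iff, ← not_lt, ← not_lt, ← not_lt, ← not_lt, key, key]

theorem Pattern.ncard_avoidanceClass (p : Pattern) (n : ℕ) :
    (avoidanceClass n p.seq).ncard = p.count n := by
  rw [Pattern.count_eq_card, ← Set.ncard_coe_finset]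
  congr 1
  ext e
  simp only [avoidanceClass, Set.mem_ofPred_eq, Finset.mem_coe, mem_maskWords, zero_add,
    IsInversionSequence]
  refine and_congr_right fun he => ?_
  have hn (i) : e i < n := (he i).trans_le i.2
  simp only [containsPattern_iff, AvoidsMasks, Nat.zero_testBit, implies_true, true_and,
    p.testBit_mask (hn _) (hn _) (hn _) (hn _), ← Bool.not_eq_true,
    Bool.and_eq_true, sameOrder_iff, Pattern.seq, Matrix.cons_val, Nat.cast_lt, and_assoc,
    not_exists, not_and]

/-! ### Patterns that are not Wilf equivalent -/

/-- The patterns of length four up to order isomorphism, each with the numbers of inversion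
sequences of length `7, 8, …` that avoid it, as far as they are needed to tell them apart. -/
def patternTable : List (Pattern × List ℕ) :=
  [(⟨0, 0, 0, 0⟩, [3863]), (⟨0, 0, 0, 1⟩, [2131]), (⟨0, 0, 1, 0⟩, [2788]), (⟨0, 0, 1, 1⟩, [2184]),
   (⟨0, 0, 1, 2⟩, [1079]), (⟨0, 0, 2, 1⟩, [2400]), (⟨0, 1, 0, 0⟩, [3655]), (⟨0, 1, 0, 1⟩, [3437]),
   (⟨0, 1, 0, 2⟩, [2087]), (⟨0, 1, 1, 0⟩, [3438]), (⟨0, 1, 1, 1⟩, [3633]), (⟨0, 1, 1, 2⟩, [2031]),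
   (⟨0, 1, 2, 0⟩, [3093]), (⟨0, 1, 2, 1⟩, [3048]), (⟨0, 1, 2, 2⟩, [3027]), (⟨0, 1, 2, 3⟩, [2060]),
   (⟨0, 1, 3, 2⟩, [3682]), (⟨0, 2, 0, 1⟩, [4357]), (⟨0, 2, 1, 0⟩, [4360]), (⟨0, 2, 1, 1⟩, [4456]),
   (⟨0, 2, 1, 2⟩, [4408]), (⟨0, 2, 1, 3⟩, [3640]), (⟨0, 2, 2, 1⟩, [4408]), (⟨0, 2, 3, 1⟩, [4216]),
   (⟨0, 3, 1, 2⟩, [4860]), (⟨0, 3, 2, 1⟩, [4860]), (⟨1, 0, 0, 0⟩, [4771]),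
   (⟨1, 0, 0, 1⟩, [4743, 36248]), (⟨1, 0, 0, 2⟩, [4203]), (⟨1, 0, 1, 0⟩, [4743, 36249]),
   (⟨1, 0, 1, 1⟩, [4745, 36312]), (⟨1, 0, 1, 2⟩, [4136]), (⟨1, 0, 2, 0⟩, [4436]),
   (⟨1, 0, 2, 1⟩, [4389]), (⟨1, 0, 2, 2⟩, [4338]), (⟨1, 0, 2, 3⟩, [3830]), (⟨1, 0, 3, 2⟩, [4420]),
   (⟨1, 1, 0, 0⟩, [4745, 36308]), (⟨1, 1, 0, 1⟩, [4745, 36312]), (⟨1, 1, 0, 2⟩, [4136]),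
   (⟨1, 1, 1, 0⟩, [4745, 36312]), (⟨1, 1, 2, 0⟩, [4387]), (⟨1, 2, 0, 0⟩, [4697]),
   (⟨1, 2, 0, 1⟩, [4668, 34944, 287603]), (⟨1, 2, 0, 2⟩, [4665]), (⟨1, 2, 0, 3⟩, [4190]),
   (⟨1, 2, 1, 0⟩, [4668, 34944, 287604]), (⟨1, 2, 2, 0⟩, [4667]), (⟨1, 2, 3, 0⟩, [4537]),
   (⟨1, 3, 0, 2⟩, [4914, 37688]), (⟨1, 3, 2, 0⟩, [4914, 37696]),
   (⟨2, 0, 0, 1⟩, [4982, 39162, 342594, 3289656]), (⟨2, 0, 1, 0⟩, [4982, 39162, 342600]),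
   (⟨2, 0, 1, 1⟩, [4982, 39162, 342594, 3289654]), (⟨2, 0, 1, 2⟩, [4980, 39094, 341050]),
   (⟨2, 0, 1, 3⟩, [4854, 36538, 297644]), (⟨2, 0, 2, 1⟩, [4980, 39090, 340874]),
   (⟨2, 0, 3, 1⟩, [4912, 37634, 315050]), (⟨2, 1, 0, 0⟩, [4982, 39168]),
   (⟨2, 1, 0, 1⟩, [4982, 39162, 342594, 3289654]), (⟨2, 1, 0, 2⟩, [4980, 39090, 340886]),
   (⟨2, 1, 0, 3⟩, [4854, 36538, 297656]), (⟨2, 1, 1, 0⟩, [4982, 39162, 342594, 3289654]),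
   (⟨2, 1, 2, 0⟩, [4980, 39094, 341054, 3259888]), (⟨2, 1, 3, 0⟩, [4912, 37634, 315054]),
   (⟨2, 2, 0, 1⟩, [4980, 39094, 341054, 3259898]), (⟨2, 2, 1, 0⟩, [4980, 39094, 341054, 3259898]),
   (⟨2, 3, 0, 1⟩, [4972]), (⟨2, 3, 1, 0⟩, [4972]), (⟨3, 0, 1, 2⟩, [5034, 40074, 356352, 3483636]),
   (⟨3, 0, 2, 1⟩, [5034, 40074, 356334, 3482538]), (⟨3, 1, 0, 2⟩, [5034, 40074, 356334, 3482556]),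
   (⟨3, 1, 2, 0⟩, [5034, 40074, 356352, 3483654]), (⟨3, 2, 0, 1⟩, [5034, 40074, 356352, 3483636]),
   (⟨3, 2, 1, 0⟩, [5034, 40074, 356352, 3483636])]

set_option maxRecDepth 100000 in
theorem count_patternTable : ∀ e ∈ patternTable,
    (List.range e.2.length).map (fun j => e.1.count (7 + j)) = e.2 := by
  -- One goal per pattern, so that each row of the table is a separate kernel computation.
  simp only [patternTable, List.forall_mem_cons]
  and_intros
  on_goal -1 => exact fun e he => absurd he List.not_mem_nil
  all_goals decide +kernel

/-- The sets of patterns that `patternTable` does not tell apart. -/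
def patternClasses : List (List Pattern) :=
  [[⟨1, 0, 1, 1⟩, ⟨1, 1, 0, 1⟩, ⟨1, 1, 1, 0⟩],
   [⟨2, 1, 1, 0⟩, ⟨2, 1, 0, 1⟩, ⟨2, 0, 1, 1⟩],
   [⟨0, 2, 2, 1⟩, ⟨0, 2, 1, 2⟩],
   [⟨0, 3, 1, 2⟩, ⟨0, 3, 2, 1⟩],
   [⟨1, 1, 0, 2⟩, ⟨1, 0, 1, 2⟩],
   [⟨2, 2, 0, 1⟩, ⟨2, 2, 1, 0⟩],
   [⟨2, 3, 0, 1⟩, ⟨2, 3, 1, 0⟩],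
   [⟨3, 2, 0, 1⟩, ⟨3, 2, 1, 0⟩, ⟨3, 0, 1, 2⟩]]

/-- `zip` compares two rows only at the lengths recorded for both, so rows may stop as soon as they
are told apart. -/
theorem eq_or_mem_patternClasses : ∀ e ∈ patternTable, ∀ f ∈ patternTable,
    (∀ x ∈ e.2.zip f.2, x.1 = x.2) → e.1 = f.1 ∨ ∃ C ∈ patternClasses, e.1 ∈ C ∧ f.1 ∈ C := by
  decide +kernel

theorem exists_mem_patternTable_of_fin : ∀ a b c d : Fin 4, ∃ e ∈ patternTable,
    sameOrder e.1.a e.1.b a b ∧ sameOrder e.1.a e.1.c a c ∧ sameOrder e.1.b e.1.c b c ∧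
      sameOrder e.1.a e.1.d a d ∧ sameOrder e.1.b e.1.d b d ∧ sameOrder e.1.c e.1.d c d := by
  decide +kernel

/-! ### Reduction of an arbitrary pattern to the table -/

theorem orderIsomorphic_of_lt_iff {k : ℕ} {α β : Type} [LinearOrder α] [LinearOrder β]
    {π : Fin k → α} {σ : Fin k → β} (h : ∀ i j, π i < π j ↔ σ i < σ j) : OrderIsomorphic π σ := by
  intro i j
  refine ⟨h i j, ?_, h j i⟩
  rw [le_antisymm_iff, le_antisymm_iff, ← not_lt, ← not_lt, ← not_lt, ← not_lt, h, h]

theorem OrderIsomorphic.symm {k : ℕ} {α β : Type} [LinearOrder α] [LinearOrder β]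
    {π : Fin k → α} {σ : Fin k → β} (h : OrderIsomorphic π σ) : OrderIsomorphic σ π :=
  orderIsomorphic_of_lt_iff fun i j => (h i j).1.symm

theorem OrderIsomorphic.trans {k : ℕ} {α β γ : Type} [LinearOrder α] [LinearOrder β]
    [LinearOrder γ] {π : Fin k → α} {σ : Fin k → β} {ρ : Fin k → γ} (h : OrderIsomorphic π σ)
    (h' : OrderIsomorphic σ ρ) : OrderIsomorphic π ρ :=
  orderIsomorphic_of_lt_iff fun i j => (h i j).1.trans (h' i j).1

/-- Each entry is replaced by its rank, the number of distinct smaller values. The rank is below `k`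
because the entry itself is among the at most `k` values and is not counted. -/
theorem exists_orderIsomorphic_fin {k : ℕ} (π : Fin k → ℤ) :
    ∃ f : Fin k → Fin k, ∀ i j, π i < π j ↔ f i < f j := by
  have hlt (i : Fin k) : ((Finset.univ.image π).filter (· < π i)).card < k := by
    calc _ < (Finset.univ.image π).card := Finset.card_lt_card
            (Finset.filter_ssubset (p := (· < π i)).2 ⟨π i, by simp, lt_irrefl _⟩)
      _ ≤ k := Finset.card_image_le.trans (by simp)
  have hmono {i j : Fin k} (h : π i < π j) : ((Finset.univ.image π).filter (· < π i)).card <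
      ((Finset.univ.image π).filter (· < π j)).card := by
    refine Finset.card_lt_card ⟨fun x hx => ?_, fun hs => ?_⟩
    · rw [Finset.mem_filter] at hx ⊢
      exact ⟨hx.1, hx.2.trans h⟩
    · exact lt_irrefl _ (Finset.mem_filter.1 (hs (Finset.mem_filter.2 ⟨by simp, h⟩))).2
  refine ⟨fun i => ⟨_, hlt i⟩, fun i j => ⟨hmono, fun h => ?_⟩⟩
  by_contra hij
  rcases (not_lt.1 hij).lt_or_eq with h' | h'
  · exact lt_asymm h (hmono h')
  · simp [h'] at h

theorem exists_mem_patternTable (π : Fin 4 → ℤ) :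
    ∃ e ∈ patternTable, OrderIsomorphic π e.1.seq := by
  obtain ⟨f, hf⟩ := exists_orderIsomorphic_fin π
  obtain ⟨e, he, h⟩ := exists_mem_patternTable_of_fin (f 0) (f 1) (f 2) (f 3)
  refine ⟨e, he, orderIsomorphic_of_lt_iff fun i j => ?_⟩
  simp only [sameOrder_iff, Fin.val_fin_lt] at h
  rw [hf]
  fin_cases i <;> fin_cases j <;> simp [Pattern.seq, h]

theorem OrderIsomorphic.avoidanceClass_eq {k : ℕ} {π σ : Fin k → ℤ} (h : OrderIsomorphic π σ)
    (n : ℕ) : avoidanceClass n π = avoidanceClass n σ := by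
  ext e
  refine and_congr_right fun _ => not_congr (exists_congr fun s => and_congr_right fun _ => ?_)
  exact ⟨fun h' => h'.trans h, fun h' => h'.trans h.symm⟩

theorem WilfEquivalent.zip_eq {e f : Pattern × List ℕ} (he : e ∈ patternTable)
    (hf : f ∈ patternTable) (h : WilfEquivalent e.1.seq f.1.seq) :
    ∀ x ∈ e.2.zip f.2, x.1 = x.2 := by
  have h' (n : ℕ) (hn : 1 ≤ n) : e.1.count n = f.1.count n := by
    simpa only [Pattern.ncard_avoidanceClass] using h n hn
  rw [← count_patternTable e he, ← count_patternTable f hf]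
  intro x hx
  obtain ⟨i, hi, rfl⟩ := List.mem_iff_getElem.1 hx
  simp [h' (7 + i) (by omega)]

theorem WilfEquivalent.orderIsomorphic_or {π σ : Fin 4 → ℤ} (h : WilfEquivalent π σ) :
    OrderIsomorphic π σ ∨ ∃ C ∈ patternClasses, (∃ p ∈ C, OrderIsomorphic π p.seq) ∧
      ∃ p ∈ C, OrderIsomorphic σ p.seq := by
  obtain ⟨e, he, hπ⟩ := exists_mem_patternTable π
  obtain ⟨f, hf, hσ⟩ := exists_mem_patternTable σ
  have hef : WilfEquivalent e.1.seq f.1.seq := fun n hn => by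
    rw [← hπ.avoidanceClass_eq, ← hσ.avoidanceClass_eq, h n hn]
  rcases eq_or_mem_patternClasses e he f hf (hef.zip_eq he hf) with heq | ⟨C, hC, hp, hq⟩
  · exact Or.inl (hπ.trans (heq ▸ hσ.symm))
  · exact Or.inr ⟨C, hC, ⟨_, hp, hπ⟩, ⟨_, hq, hσ⟩⟩

/-! ### Binary words avoiding a subsequence -/

/-- `subwordFreeSum p f g` is the sum of `g` of the number of entries `true`, over the binary words
of length `f` that do not have the subsequence `p`. -/
def subwordFreeSum : List Bool → ℕ → (ℕ → ℕ) → ℕ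
  | [], _, _ => 0
  | _ :: _, 0, g => g 0
  | b :: p, f + 1, g => subwordFreeSum p f (fun k => g (k + b.toNat)) +
      subwordFreeSum (b :: p) f (fun k => g (k + (!b).toNat))

/-- Write W(p, g) for the sum at length `f` and g⁺ for g(· + 1). Splitting off the first letter of
words of length `f + 1`, the case of 10p against 01p becomes, after induction, W(0p, g⁺) + W(10p, g)
= W(1p, g) + W(10p, g⁺). This is `shift`, which splits off a letter once more and reduces to itself
at the smaller length. -/
theorem subwordFreeSum_swap (a b : Bool) (p : List Bool) (f : ℕ) (g : ℕ → ℕ) :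
    subwordFreeSum (a :: b :: p) f g = subwordFreeSum (b :: a :: p) f g := by
  have shift (p : List Bool) (f : ℕ) : ∀ g : ℕ → ℕ,
      subwordFreeSum (false :: p) f (fun k => g (k + 1)) + subwordFreeSum (true :: false :: p) f g =
      subwordFreeSum (true :: p) f g +
        subwordFreeSum (true :: false :: p) f (fun k => g (k + 1)) := by
    induction f with
    | zero => intro g; simp [subwordFreeSum, add_comm]
    | succ f ih =>
      intro g
      have := ih g
      simp only [subwordFreeSum, Bool.toNat_true, Bool.toNat_false, Bool.not_true, Bool.not_false,
        add_zero] at this ⊢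
      linarith
  have main (p : List Bool) (f : ℕ) : ∀ g : ℕ → ℕ,
      subwordFreeSum (true :: false :: p) f g = subwordFreeSum (false :: true :: p) f g := by
    induction f with
    | zero => intro g; rfl
    | succ f ih =>
      intro g
      have := shift p f g
      simp only [subwordFreeSum, Bool.toNat_true, Bool.toNat_false, Bool.not_true, Bool.not_false,
        add_zero, ← ih]
      exact this
  cases a <;> cases b
  · rfl
  · exact (main p f g).symm
  · exact main p f g
  · rfl

/-- As `g` is arbitrary, this says that the avoiding words are equidistributed by their number of
ones. -/
theorem subwordFreeSum_perm {p q : List Bool} (h : p.Perm q) :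
    ∀ (f : ℕ) (g : ℕ → ℕ), subwordFreeSum p f g = subwordFreeSum q f g := by
  induction h with
  | nil => exact fun _ _ => rfl
  | cons x _ ih =>
    intro f
    induction f with
    | zero => exact fun _ => rfl
    | succ f ihf => intro g; simp only [subwordFreeSum, ih, ihf]
  | swap x y l => exact subwordFreeSum_swap _ _ _
  | trans _ _ ih₁ ih₂ => exact fun f g => (ih₁ f g).trans (ih₂ f g)

theorem cons_sublist_cons_iff_ite (a b : Bool) (p l : List Bool) :
    (a :: p).Sublist (b :: l) ↔ (if a = b then p.Sublist l else (a :: p).Sublist l) := by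
  split_ifs with h
  · rw [h, List.cons_sublist_cons]
  · rw [List.sublist_cons_iff]
    simp [h]

theorem sum_powerset_not_sublist {α : Type} [DecidableEq α] {l : List α} (hl : l.Nodup) (p : List Bool)
    (g : ℕ → ℕ) : (∑ S ∈ l.toFinset.powerset,
      if p.Sublist (l.map fun i => decide (i ∈ S)) then 0 else g S.card) =
        subwordFreeSum p l.length g := by
  induction l generalizing p g with
  | nil => cases p <;> simp [subwordFreeSum]
  | cons a l ih =>
    obtain ⟨ha, hl⟩ := List.nodup_cons.1 hl
    cases p with
    | nil => simp [subwordFreeSum]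
    | cons b p =>
      have ha' : a ∉ l.toFinset := by simpa using ha
      have h1 {S : Finset α} (hS : S ∈ l.toFinset.powerset) : a ∉ S := fun h =>
        ha' (Finset.mem_powerset.1 hS h)
      have h2 (S : Finset α) : (l.map fun i => decide (i ∈ insert a S)) =
          l.map fun i => decide (i ∈ S) := by
        refine List.map_congr_left fun i hi => ?_
        have : i ≠ a := fun h => ha (h ▸ hi)
        simp [this]
      rw [List.toFinset_cons, Finset.sum_powerset_insert ha', List.length_cons]
      simp only [List.map_cons, h2, Finset.mem_insert_self, decide_true, cons_sublist_cons_iff_ite]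
      cases b
      · simp only [subwordFreeSum, Bool.toNat_false, Bool.not_false, Bool.toNat_true, add_zero,
          ← ih hl]
        congr 1
        · exact Finset.sum_congr rfl fun S hS => by simp [h1 hS]
        · exact Finset.sum_congr rfl fun S hS => by simp [Finset.card_insert_of_notMem (h1 hS)]
      · simp only [subwordFreeSum, Bool.toNat_false, Bool.not_true, Bool.toNat_true, add_zero,
          ← ih hl]
        rw [add_comm]
        congr 1
        · exact Finset.sum_congr rfl fun S hS => by simp [Finset.card_insert_of_notMem (h1 hS)]
        · exact Finset.sum_congr rfl fun S hS => by simp [h1 hS]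

/-! ### Fillings of a Ferrers shape, row by row

A word `w` is seen as a filling with one cell in row `w i` of column `i`, where column `i` has the
rows `1, …, h i`; the value `0` stands for a column that is not filled (yet). -/

/-- The part of the filling above row `v`. -/
def above {n : ℕ} (v : ℕ) (w : Fin n → ℕ) : Fin n → ℕ := fun i => if v < w i then w i else 0

/-- A rule that assigns to each partial filling a set of columns, its zone. The zone grows with the
filling, and whether a column enters it depends on the columns outside of it only. -/
structure ZoneRule (n : ℕ) where
  /-- The zone of a partial filling. -/
  zone : (Fin n → ℕ) → Set (Fin n)
  mono : ∀ p p', (∀ i, p i ≠ 0 → p' i = p i) → zone p ⊆ zone p'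
  mem_of_eq : ∀ p p' q' i, i ∈ zone p' → i ∉ zone p → (∀ j ∉ zone p, p' j = q' j) → i ∈ zone q'

/-- The cells of row `v` set to `v` in the columns `S`. -/
def fillRow {n : ℕ} (p : Fin n → ℕ) (S : Finset (Fin n)) (v : ℕ) : Fin n → ℕ :=
  fun i => if i ∈ S then v else p i

section Rows

variable {n : ℕ} (Z : ZoneRule n) (h : Fin n → ℕ)

open Classical in
/-- The columns of the zone of `p` that meet row `v` and are not filled. -/
noncomputable def freeColumns (v : ℕ) (p : Fin n → ℕ) : Finset (Fin n) :=
  Finset.univ.filter fun i => i ∈ Z.zone p ∧ p i = 0 ∧ v ≤ h i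

/-- Along the free columns, the indicator word of the entries in row `v` has no subsequence `b`. -/
def RowAvoids (b : List Bool) (v : ℕ) (w : Fin n → ℕ) : Prop :=
  ¬ b.Sublist ((freeColumns Z h v (above v w)).sort.map fun i => decide (w i = v))

open Classical in
/-- The fillings that extend the filling `p` of the rows above `v` and obey the condition in the
rows `1, …, v`. -/
noncomputable def completions (b : List Bool) (v : ℕ) (p : Fin n → ℕ) : Finset (Fin n → ℕ) :=
  (Fintype.piFinset fun i => Finset.range (h i + 1)).filter fun w =>
    (∀ i, w i = 0 → h i = 0) ∧ above v w = p ∧ ∀ u, 1 ≤ u → u ≤ v → RowAvoids Z h b u w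

variable {Z h}

theorem mem_freeColumns {v : ℕ} {p : Fin n → ℕ} {i : Fin n} :
    i ∈ freeColumns Z h v p ↔ i ∈ Z.zone p ∧ p i = 0 ∧ v ≤ h i := by
  simp [freeColumns]

theorem mem_completions {b : List Bool} {v : ℕ} {p w : Fin n → ℕ} :
    w ∈ completions Z h b v p ↔ (∀ i, w i ≤ h i) ∧ (∀ i, w i = 0 → h i = 0) ∧ above v w = p ∧
      ∀ u, 1 ≤ u → u ≤ v → RowAvoids Z h b u w := by
  simp [completions]

theorem above_eq_fillRow_iff {v : ℕ} {p w : Fin n → ℕ} {S : Finset (Fin n)}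
    (hp : ∀ i, p i ≠ 0 → v + 1 < p i) (hS : ∀ i ∈ S, p i = 0) :
    above v w = fillRow p S (v + 1) ↔
      above (v + 1) w = p ∧ Finset.univ.filter (fun i => w i = v + 1) = S := by
  simp only [funext_iff, Finset.ext_iff, Finset.mem_filter, Finset.mem_univ, true_and,
    ← forall_and]
  refine forall_congr' fun i => ?_
  have h1 := hp i
  have h2 := hS i
  simp only [above, fillRow]
  by_cases hi : i ∈ S
  · have := h2 hi
    simp only [hi, if_true, iff_true]
    split_ifs <;> grind
  · simp only [hi, if_false, iff_false]
    split_ifs <;> grind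

open Classical in
-- `S` is the set of columns with entry in row `v + 1`. The free columns of that row are determined
-- by `p`, so the condition on the row involves `S` alone.
theorem card_completions_succ {b : List Bool} {v : ℕ} {p : Fin n → ℕ}
    (hp : ∀ i, p i ≠ 0 → v + 1 < p i) :
    (completions Z h b (v + 1) p).card =
      ∑ S ∈ (Finset.univ.filter fun i => p i = 0 ∧ v + 1 ≤ h i).powerset,
        if b.Sublist ((freeColumns Z h (v + 1) p).sort.map fun i => decide (i ∈ S)) then 0
        else (completions Z h b v (fillRow p S (v + 1))).card := by
  rw [Finset.card_eq_sum_card_fiberwise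
    (f := fun w : Fin n → ℕ => Finset.univ.filter fun i => w i = v + 1)
    (t := (Finset.univ.filter fun i => p i = 0 ∧ v + 1 ≤ h i).powerset)]
  · refine Finset.sum_congr rfl fun S hS => ?_
    have hS' : ∀ i ∈ S, p i = 0 := fun i hi =>
      (Finset.mem_filter.1 (Finset.mem_powerset.1 hS hi)).2.1
    have key (w : Fin n → ℕ) : w ∈ (completions Z h b (v + 1) p).filter
        (fun w => Finset.univ.filter (fun i => w i = v + 1) = S) ↔
        ¬ b.Sublist ((freeColumns Z h (v + 1) p).sort.map fun i => decide (i ∈ S)) ∧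
          w ∈ completions Z h b v (fillRow p S (v + 1)) := by
      rw [Finset.mem_filter, mem_completions, mem_completions, above_eq_fillRow_iff hp hS']
      have hrow : above (v + 1) w = p → Finset.univ.filter (fun i => w i = v + 1) = S →
          (RowAvoids Z h b (v + 1) w ↔
            ¬ b.Sublist ((freeColumns Z h (v + 1) p).sort.map fun i => decide (i ∈ S))) := by
        rintro rfl rfl
        simp [RowAvoids]
      have hsplit : (∀ u, 1 ≤ u → u ≤ v + 1 → RowAvoids Z h b u w) ↔
          RowAvoids Z h b (v + 1) w ∧ ∀ u, 1 ≤ u → u ≤ v → RowAvoids Z h b u w := by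
        refine ⟨fun H => ⟨H _ (by omega) le_rfl, fun u h1 h2 => H u h1 (by omega)⟩,
          fun H u h1 h2 => ?_⟩
        rcases Nat.lt_or_eq_of_le h2 with h3 | rfl
        · exact H.2 u h1 (by omega)
        · exact H.1
      rw [hsplit]
      tauto
    split_ifs with hb
    · rw [Finset.card_eq_zero, Finset.eq_empty_iff_forall_notMem]
      exact fun w hw => ((key w).1 hw).1 hb
    · congr 1
      ext w
      rw [key]
      simp [hb]
  · intro w hw
    obtain ⟨h1, -, rfl, -⟩ := mem_completions.1 (Finset.mem_coe.1 hw)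
    simp only [Finset.coe_powerset, Set.mem_preimage, Set.mem_powerset_iff, Finset.coe_subset]
    intro i hi
    have hi := (Finset.mem_filter.1 hi).2
    have := h1 i
    rw [hi] at this
    simpa [above, hi] using this

open Classical in
theorem card_completions_zero {b : List Bool} {p : Fin n → ℕ} (hp : ∀ i, p i ≤ h i) :
    (completions Z h b 0 p).card = if ∀ i, p i = 0 → h i = 0 then 1 else 0 := by
  have ha (w : Fin n → ℕ) : above 0 w = w := by
    funext i
    simp only [above]
    split_ifs <;> omega
  have key (w : Fin n → ℕ) : w ∈ completions Z h b 0 p ↔ (∀ i, p i = 0 → h i = 0) ∧ w = p := by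
    rw [mem_completions, ha]
    constructor
    · rintro ⟨-, h2, rfl, -⟩
      exact ⟨h2, rfl⟩
    · rintro ⟨h2, rfl⟩
      exact ⟨hp, h2, rfl, fun u h1 h2 => by omega⟩
  split_ifs with hz
  · rw [Finset.card_eq_one]
    exact ⟨p, by ext w; rw [key, Finset.mem_singleton]; exact and_iff_right hz⟩
  · rw [Finset.card_eq_zero, Finset.eq_empty_iff_forall_notMem]
    exact fun w hw => hz ((key w).1 hw).1

theorem sum_powerset_disjUnion {α M : Type} [DecidableEq α] [AddCommMonoid M] {A B : Finset α}
    (hAB : Disjoint A B) (f : Finset α → M) :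
    ∑ S ∈ (A ∪ B).powerset, f S = ∑ S ∈ A.powerset, ∑ T ∈ B.powerset, f (S ∪ T) := by
  rw [← Finset.sum_product']
  symm
  refine Finset.sum_nbij' (fun x => x.1 ∪ x.2) (fun S => (S ∩ A, S ∩ B)) ?_ ?_ ?_ ?_ ?_
  · intro x hx
    simp only [Finset.mem_product, Finset.mem_powerset] at hx ⊢
    exact Finset.union_subset_union hx.1 hx.2
  · intro S _
    simp
  · rintro ⟨S, T⟩ hx
    simp only [Finset.mem_product, Finset.mem_powerset] at hx
    have h1 : S ∩ B = ∅ := Finset.disjoint_iff_inter_eq_empty.1 (hAB.mono_left hx.1)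
    have h2 : T ∩ A = ∅ := Finset.disjoint_iff_inter_eq_empty.1 (hAB.symm.mono_left hx.2)
    simp [Finset.union_inter_distrib_right, h1, h2, Finset.inter_eq_left.2 hx.1,
      Finset.inter_eq_left.2 hx.2]
  · intro S hS
    rw [Finset.mem_powerset] at hS
    simp [← Finset.inter_union_distrib_left, Finset.inter_eq_left.2 hS]
  · intro x _
    rfl

/-- Two partial fillings of the rows above `v` are interchangeable if they have the same zone,
agree outside of it, and have equally many free columns in it. -/
structure Interchangeable (Z : ZoneRule n) (h : Fin n → ℕ) (v : ℕ) (p q : Fin n → ℕ) : Prop where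
  lt_left : ∀ i, p i ≠ 0 → v < p i
  lt_right : ∀ i, q i ≠ 0 → v < q i
  le_left : ∀ i, p i ≤ h i
  le_right : ∀ i, q i ≤ h i
  zone_eq : Z.zone p = Z.zone q
  eq_off : ∀ i ∉ Z.zone p, p i = q i
  card_eq : ∀ u ≤ v + 1, (freeColumns Z h u p).card = (freeColumns Z h u q).card

theorem Interchangeable.right_refl {v : ℕ} {p q : Fin n → ℕ} (H : Interchangeable Z h v p q) :
    Interchangeable Z h v q q :=
  ⟨H.lt_right, H.lt_right, H.le_right, H.le_right, rfl, fun _ _ => rfl, fun _ _ => rfl⟩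

/-- A column of the old zone stays by `mono`; a new one enters for reasons outside of the old zone,
where `p'` and `q'` agree. -/
theorem zone_subset_of_eq_off {p q p' q' : Fin n → ℕ} (hz : Z.zone p = Z.zone q)
    (hq : ∀ i, q i ≠ 0 → q' i = q i) (hoff : ∀ i ∉ Z.zone p, p' i = q' i) :
    Z.zone p' ⊆ Z.zone q' := by
  intro i hi
  by_cases h : i ∈ Z.zone p
  · exact Z.mono q q' hq (hz ▸ h)
  · exact Z.mem_of_eq p p' q' i hi h hoff

theorem fillRow_of_ne_zero {p : Fin n → ℕ} {S : Finset (Fin n)} {v : ℕ} (hS : ∀ i ∈ S, p i = 0)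
    {i : Fin n} (hi : p i ≠ 0) : fillRow p S v i = p i :=
  if_neg fun h => hi (hS i h)

open Classical in
-- The columns of `S₂` reach row `v`, hence also row `u`, so exactly `S₂` is lost in the old zone;
-- all gains are columns that newly enter the zone.
theorem card_freeColumns_fillRow {p : Fin n → ℕ} {S₁ S₂ : Finset (Fin n)} {v u : ℕ} (hu : u ≤ v)
    (hv : v ≠ 0) (h₁ : ∀ i ∈ S₁, p i = 0 ∧ i ∉ Z.zone p) (h₂ : S₂ ⊆ freeColumns Z h v p) :
    (freeColumns Z h u (fillRow p (S₁ ∪ S₂) v)).card + S₂.card =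
      (freeColumns Z h u p).card + (Finset.univ.filter fun i =>
        i ∈ Z.zone (fillRow p (S₁ ∪ S₂) v) ∧ i ∉ Z.zone p ∧
          fillRow p (S₁ ∪ S₂) v i = 0 ∧ u ≤ h i).card := by
  have h0 : ∀ i ∈ S₁ ∪ S₂, p i = 0 := fun i hi => (Finset.mem_union.1 hi).elim
    (fun hi => (h₁ i hi).1) (fun hi => (mem_freeColumns.1 (h₂ hi)).2.1)
  have hz : Z.zone p ⊆ Z.zone (fillRow p (S₁ ∪ S₂) v) :=
    Z.mono _ _ fun i hi => fillRow_of_ne_zero h0 hi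
  have hd (i : Fin n) (hi : i ∈ Z.zone p) : fillRow p (S₁ ∪ S₂) v i = 0 ↔ p i = 0 ∧ i ∉ S₂ := by
    have : i ∉ S₁ := fun h => (h₁ i h).2 hi
    simp only [fillRow, Finset.mem_union, this, false_or]
    split_ifs with h <;> simp [h, hv]
  rw [← Finset.card_union_of_disjoint, ← Finset.card_union_of_disjoint]
  · congr 1
    ext i
    simp only [Finset.mem_union, mem_freeColumns, Finset.mem_filter, Finset.mem_univ, true_and]
    by_cases hi : i ∈ Z.zone p
    · have := @h₂ i
      rw [mem_freeColumns] at this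
      simp only [hz hi, hi, hd i hi, true_and, not_true, false_and, and_false, or_false]
      by_cases hS : i ∈ S₂
      · have := this hS
        simp [hS, this.2.1, hu.trans this.2.2]
      · simp [hS]
    · have : i ∉ S₂ := fun h => hi (mem_freeColumns.1 (h₂ h)).1
      simp [hi, this]
  · rw [Finset.disjoint_left]
    intro i hi hi'
    exact (Finset.mem_filter.1 hi').2.2.1 (mem_freeColumns.1 hi).1
  · rw [Finset.disjoint_left]
    intro i hi hi'
    have := mem_freeColumns.1 hi
    exact ((hd i (mem_freeColumns.1 (h₂ hi')).1).1 this.2.1).2 hi'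

open Classical in
-- Both sides lose equally many free columns since `S₂` and `T₂` have the same size, and gain the
-- same ones (`e3`), since newly entering columns lie where the two fillings agree.
theorem Interchangeable.fillRow {v : ℕ} {p q : Fin n → ℕ} (H : Interchangeable Z h (v + 1) p q)
    {S₁ S₂ T₂ : Finset (Fin n)} (h₁ : ∀ i ∈ S₁, p i = 0 ∧ v + 1 ≤ h i ∧ i ∉ Z.zone p)
    (hS : S₂ ⊆ freeColumns Z h (v + 1) p) (hT : T₂ ⊆ freeColumns Z h (v + 1) q)
    (hc : S₂.card = T₂.card) :
    Interchangeable Z h v (fillRow p (S₁ ∪ S₂) (v + 1)) (fillRow q (S₁ ∪ T₂) (v + 1)) := by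
  have hS' (i) (hi : i ∈ S₂) := mem_freeColumns.1 (hS hi)
  have hT' (i) (hi : i ∈ T₂) := mem_freeColumns.1 (hT hi)
  have h₁' : ∀ i ∈ S₁, q i = 0 ∧ v + 1 ≤ h i ∧ i ∉ Z.zone q := fun i hi =>
    ⟨(H.eq_off i (h₁ i hi).2.2).symm.trans (h₁ i hi).1, (h₁ i hi).2.1, H.zone_eq ▸ (h₁ i hi).2.2⟩
  have hp0 : ∀ i ∈ S₁ ∪ S₂, p i = 0 ∧ v + 1 ≤ h i := fun i hi => (Finset.mem_union.1 hi).elim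
    (fun hi => ⟨(h₁ i hi).1, (h₁ i hi).2.1⟩) (fun hi => (hS' i hi).2)
  have hq0 : ∀ i ∈ S₁ ∪ T₂, q i = 0 ∧ v + 1 ≤ h i := fun i hi => (Finset.mem_union.1 hi).elim
    (fun hi => ⟨(h₁' i hi).1, (h₁' i hi).2.1⟩) (fun hi => (hT' i hi).2)
  have hoff : ∀ i ∉ Z.zone p,
      _root_.fillRow p (S₁ ∪ S₂) (v + 1) i = _root_.fillRow q (S₁ ∪ T₂) (v + 1) i := by
    intro i hi
    have h1 : i ∉ S₂ := fun h => hi (hS' i h).1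
    have h2 : i ∉ T₂ := fun h => hi (H.zone_eq ▸ (hT' i h).1)
    simp [_root_.fillRow, h1, h2, H.eq_off i hi]
  have hz : Z.zone (_root_.fillRow p (S₁ ∪ S₂) (v + 1)) =
      Z.zone (_root_.fillRow q (S₁ ∪ T₂) (v + 1)) :=
    Set.Subset.antisymm
      (zone_subset_of_eq_off H.zone_eq (fun i => fillRow_of_ne_zero fun i hi => (hq0 i hi).1) hoff)
      (zone_subset_of_eq_off H.zone_eq.symm
        (fun i => fillRow_of_ne_zero fun i hi => (hp0 i hi).1)
        fun i hi => (hoff i (H.zone_eq ▸ hi)).symm)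
  refine ⟨fun i hi => ?_, fun i hi => ?_, fun i => ?_, fun i => ?_, hz, fun i hi => ?_,
    fun u hu => ?_⟩
  · simp only [_root_.fillRow] at hi ⊢
    split_ifs with h
    · omega
    · rw [if_neg h] at hi
      have := H.lt_left i hi
      omega
  · simp only [_root_.fillRow] at hi ⊢
    split_ifs with h
    · omega
    · rw [if_neg h] at hi
      have := H.lt_right i hi
      omega
  · simp only [_root_.fillRow]
    split_ifs with h
    · exact (hp0 i h).2
    · exact H.le_left i
  · simp only [_root_.fillRow]
    split_ifs with h
    · exact (hq0 i h).2
    · exact H.le_right i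
  · exact hoff i fun h => hi (Z.mono _ _ (fun i => fillRow_of_ne_zero fun i hi => (hp0 i hi).1) h)
  · have e1 := card_freeColumns_fillRow (Z := Z) (h := h) hu (Nat.succ_ne_zero v)
      (fun i hi => ⟨(h₁ i hi).1, (h₁ i hi).2.2⟩) hS
    have e2 := card_freeColumns_fillRow (Z := Z) (h := h) hu (Nat.succ_ne_zero v)
      (fun i hi => ⟨(h₁' i hi).1, (h₁' i hi).2.2⟩) hT
    have e3 : (Finset.univ.filter fun i => i ∈ Z.zone (_root_.fillRow p (S₁ ∪ S₂) (v + 1)) ∧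
          i ∉ Z.zone p ∧ _root_.fillRow p (S₁ ∪ S₂) (v + 1) i = 0 ∧ u ≤ h i) =
        Finset.univ.filter fun i => i ∈ Z.zone (_root_.fillRow q (S₁ ∪ T₂) (v + 1)) ∧
          i ∉ Z.zone q ∧ _root_.fillRow q (S₁ ∪ T₂) (v + 1) i = 0 ∧ u ≤ h i := by
      refine Finset.filter_congr fun i _ => ?_
      rw [hz, ← H.zone_eq]
      refine and_congr_right fun _ => and_congr_right fun hi => ?_
      rw [hoff i hi]
    have e4 := H.card_eq u (by omega)
    rw [e3] at e1
    omega

open Classical in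
-- By `hf` and `hf'` the summands depend only on the size of the subset, so both sums are
-- `subwordFreeSum` for one weight, evaluated at a representative `T k` of each size.
theorem sum_powerset_freeColumns {b b' : List Bool} (hb : b.Perm b') {F F' : Finset (Fin n)}
    (hF : F.card = F'.card) {f f' : Finset (Fin n) → ℕ}
    (hf : ∀ S ⊆ F, ∀ T ⊆ F', S.card = T.card → f S = f' T)
    (hf' : ∀ S ⊆ F', ∀ T ⊆ F', S.card = T.card → f' S = f' T) :
    (∑ S ∈ F.powerset, if b.Sublist (F.sort.map fun i => decide (i ∈ S)) then 0 else f S) =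
      ∑ S ∈ F'.powerset, if b'.Sublist (F'.sort.map fun i => decide (i ∈ S)) then 0 else f' S := by
  have hex : ∀ k ≤ F'.card, ∃ T ⊆ F', T.card = k := fun k hk => Finset.exists_subset_card_eq hk
  choose! T hT hTc using hex
  have e1 := sum_powerset_not_sublist (l := F.sort) (Finset.sort_nodup F _) b fun k => f' (T k)
  have e2 := sum_powerset_not_sublist (l := F'.sort) (Finset.sort_nodup F' _) b' fun k => f' (T k)
  rw [Finset.length_sort, Finset.sort_toFinset] at e1 e2
  rw [subwordFreeSum_perm hb, hF, ← e2] at e1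
  convert e1 using 1
  · refine Finset.sum_congr rfl fun S hS => ?_
    rw [Finset.mem_powerset] at hS
    have hc : S.card ≤ F'.card := hF ▸ Finset.card_le_card hS
    rw [hf S hS (T S.card) (hT _ hc) (hTc _ hc).symm]
  · refine Finset.sum_congr rfl fun S hS => ?_
    rw [Finset.mem_powerset] at hS
    have hc : S.card ≤ F'.card := Finset.card_le_card hS
    rw [hf' S hS (T S.card) (hT _ hc) (hTc _ hc).symm]

open Classical in
-- The word and the filling vary together because permuting the word trades one set of columns in
-- the current row for another of the same size, which changes the filling passed to the lower rows.
theorem Interchangeable.card_completions_eq {v : ℕ} : ∀ {p q : Fin n → ℕ} {b b' : List Bool},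
    b.Perm b' → Interchangeable Z h v p q →
      (completions Z h b v p).card = (completions Z h b' v q).card := by
  induction v with
  | zero =>
    intro p q b b' _ H
    rw [card_completions_zero H.le_left, card_completions_zero H.le_right]
    -- The free columns of row 1 are the columns of the zone wrongly left empty; this is why
    -- `card_eq` reaches up to row `v + 1`.
    have aux (p : Fin n → ℕ) : (∀ i, p i = 0 → h i = 0) ↔
        (∀ i ∉ Z.zone p, p i = 0 → h i = 0) ∧ (freeColumns Z h 1 p).card = 0 := by
      rw [Finset.card_eq_zero, Finset.eq_empty_iff_forall_notMem, ← forall_and]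
      refine forall_congr' fun i => ?_
      rw [mem_freeColumns, Nat.one_le_iff_ne_zero]
      tauto
    have : (∀ i, p i = 0 → h i = 0) ↔ ∀ i, q i = 0 → h i = 0 := by
      rw [aux p, aux q, H.card_eq 1 le_rfl, ← H.zone_eq]
      refine and_congr_left fun _ => forall_congr' fun i => forall_congr' fun hi => ?_
      rw [H.eq_off i hi]
    simp only [this]
  | succ v ih =>
    intro p q b b' hb H
    rw [card_completions_succ H.lt_left, card_completions_succ H.lt_right]
    set A := Finset.univ.filter fun i => (p i = 0 ∧ v + 1 ≤ h i) ∧ i ∉ Z.zone p with hA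
    have mem_A {i} : i ∈ A ↔ (p i = 0 ∧ v + 1 ≤ h i) ∧ i ∉ Z.zone p := by simp [hA]
    have hp : (Finset.univ.filter fun i => p i = 0 ∧ v + 1 ≤ h i) =
        A ∪ freeColumns Z h (v + 1) p := by
      ext i
      simp only [Finset.mem_filter, Finset.mem_univ, true_and, Finset.mem_union, mem_A,
        mem_freeColumns]
      tauto
    have hq : (Finset.univ.filter fun i => q i = 0 ∧ v + 1 ≤ h i) =
        A ∪ freeColumns Z h (v + 1) q := by
      ext i
      simp only [Finset.mem_filter, Finset.mem_univ, true_and, Finset.mem_union, mem_A,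
        mem_freeColumns, ← H.zone_eq]
      by_cases hi : i ∈ Z.zone p
      · simp [hi]
      · simp [hi, H.eq_off i hi]
    have dp : Disjoint A (freeColumns Z h (v + 1) p) := Finset.disjoint_left.2 fun i hi hi' =>
      (mem_A.1 hi).2 (mem_freeColumns.1 hi').1
    have dq : Disjoint A (freeColumns Z h (v + 1) q) := Finset.disjoint_left.2 fun i hi hi' =>
      (mem_A.1 hi).2 (H.zone_eq ▸ (mem_freeColumns.1 hi').1)
    rw [hp, hq, sum_powerset_disjUnion dp, sum_powerset_disjUnion dq]
    refine Finset.sum_congr rfl fun S₁ hS₁ => ?_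
    have hS₁' : ∀ i ∈ S₁, p i = 0 ∧ v + 1 ≤ h i ∧ i ∉ Z.zone p := fun i hi =>
      and_assoc.1 (mem_A.1 (Finset.mem_powerset.1 hS₁ hi))
    have hqS : ∀ i ∈ S₁, q i = 0 ∧ v + 1 ≤ h i ∧ i ∉ Z.zone q := fun i hi =>
      ⟨(H.eq_off i (hS₁' i hi).2.2).symm.trans (hS₁' i hi).1, (hS₁' i hi).2.1,
        H.zone_eq ▸ (hS₁' i hi).2.2⟩
    -- The part `S₁` of the row lies outside the zone and is invisible to the row condition.
    have drop {F : Finset (Fin n)} (hd : Disjoint A F) (S : Finset (Fin n)) :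
        (F.sort.map fun i => decide (i ∈ S₁ ∪ S)) = F.sort.map fun i => decide (i ∈ S) := by
      refine List.map_congr_left fun i hi => ?_
      have : i ∉ S₁ := fun h => Finset.disjoint_left.1 hd (Finset.mem_powerset.1 hS₁ h)
        ((Finset.mem_sort _).1 hi)
      simp [this]
    simp only [drop dp, drop dq]
    refine sum_powerset_freeColumns hb (H.card_eq _ (by omega)) (fun S hS T hT hc => ?_)
      fun S hS T hT hc => ?_
    · exact ih hb (H.fillRow hS₁' hS hT hc)
    · exact ih (List.Perm.refl _) (H.right_refl.fillRow hqS hS hT hc)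

variable (Z h) in
/-- The fillings of the shape whose columns have heights `h` that obey the condition in each of the
rows `1, …, N`. -/
def rowAvoiders (b : List Bool) (N : ℕ) : Set (Fin n → ℕ) :=
  {w | (∀ i, w i ≤ h i) ∧ (∀ i, w i = 0 → h i = 0) ∧ ∀ u, 1 ≤ u → u ≤ N → RowAvoids Z h b u w}

theorem ncard_rowAvoiders_eq {b b' : List Bool} (hb : b.Perm b') {N : ℕ} (hN : ∀ i, h i ≤ N) :
    (rowAvoiders Z h b N).ncard = (rowAvoiders Z h b' N).ncard := by
  have key (b : List Bool) :
      rowAvoiders Z h b N = (completions Z h b N (fun _ => 0) : Set (Fin n → ℕ)) := by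
    ext w
    simp only [rowAvoiders, Set.mem_ofPred_eq, Finset.mem_coe, mem_completions]
    refine and_congr_right fun hw => and_congr_right fun _ => ?_
    have : above N w = fun _ => 0 := by
      funext i
      exact if_neg (not_lt.2 ((hw i).trans (hN i)))
    simp [this]
  rw [key, key, Set.ncard_coe_finset, Set.ncard_coe_finset]
  exact Interchangeable.card_completions_eq hb
    ⟨by simp, by simp, by simp, by simp, rfl, fun _ _ => rfl, fun _ _ => rfl⟩

end Rows

/-! ### The Wilf equivalences -/

theorem sublist_map_sort_iff {n : ℕ} {F : Finset (Fin n)} {f : Fin n → Bool} {b : List Bool} :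
    b.Sublist (F.sort.map f) ↔
      ∃ l : List (Fin n), l.Pairwise (· < ·) ∧ (∀ i ∈ l, i ∈ F) ∧ l.map f = b := by
  rw [List.sublist_map_iff]
  constructor
  · rintro ⟨l, hl, rfl⟩
    exact ⟨l, (Finset.sortedLT_sort F).pairwise.sublist hl,
      fun i hi => (Finset.mem_sort _).1 (hl.subset hi), rfl⟩
  · rintro ⟨l, hl, hF, rfl⟩
    refine ⟨l, List.sublist_of_subperm_of_sortedLE (List.Nodup.subperm
      (hl.imp fun h => h.ne) fun i hi => (Finset.mem_sort _).2 (hF i hi))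
      (hl.imp fun h => h.le).sortedLE (Finset.sortedLT_sort F).sortedLE, rfl⟩

section

variable {n : ℕ} (Z : ZoneRule n) (h w : Fin n → ℕ)

/-- Column `i` is free in row `v` when the rows above `v` are filled, and `x` tells whether its
entry is in row `v`. -/
def RowEntry (v : ℕ) (i : Fin n) (x : Bool) : Prop :=
  i ∈ Z.zone (above v w) ∧ v ≤ h i ∧ if x then w i = v else w i < v

variable {Z h w}

theorem above_eq_zero_iff {v : ℕ} {i : Fin n} : above v w i = 0 ↔ w i ≤ v := by
  simp only [above]
  split_ifs <;> omega

theorem above_pos_iff {v : ℕ} {i : Fin n} : 0 < above v w i ↔ v < w i := by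
  rw [Nat.pos_iff_ne_zero, Ne, above_eq_zero_iff, not_le]

theorem above_of_lt {v : ℕ} {i : Fin n} (hi : v < w i) : above v w i = w i := if_pos hi

theorem rowEntry_iff {v : ℕ} {i : Fin n} {x : Bool} :
    RowEntry Z h w v i x ↔ i ∈ freeColumns Z h v (above v w) ∧ decide (w i = v) = x := by
  rw [RowEntry, mem_freeColumns, above_eq_zero_iff]
  cases x
  · simp only [Bool.false_eq_true, if_false, decide_eq_false_iff_not, lt_iff_le_and_ne]
    tauto
  · simp only [if_true, decide_eq_true_eq]
    constructor
    · rintro ⟨h1, h2, h3⟩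
      exact ⟨⟨h1, h3.le, h2⟩, h3⟩
    · rintro ⟨⟨h1, -, h2⟩, h3⟩
      exact ⟨h1, h2, h3⟩

theorem not_rowAvoids_iff_pair {v : ℕ} {x y : Bool} : ¬ RowAvoids Z h [x, y] v w ↔
    ∃ i j, i < j ∧ RowEntry Z h w v i x ∧ RowEntry Z h w v j y := by
  simp only [RowAvoids, not_not, sublist_map_sort_iff, rowEntry_iff]
  constructor
  · rintro ⟨l, h1, h2, h3⟩
    match l, h3 with
    | [i, j], h3 =>
      simp only [List.map_cons, List.map_nil, List.cons.injEq, and_true] at h3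
      exact ⟨i, j, by simpa using h1, ⟨h2 i (by simp), h3.1⟩, ⟨h2 j (by simp), h3.2⟩⟩
  · rintro ⟨i, j, hij, h1, h2⟩
    exact ⟨[i, j], by simp [hij], by simp [h1.1, h2.1], by simp [h1.2, h2.2]⟩

theorem not_rowAvoids_iff_triple {v : ℕ} {x y z : Bool} : ¬ RowAvoids Z h [x, y, z] v w ↔
    ∃ i j k, i < j ∧ j < k ∧ RowEntry Z h w v i x ∧ RowEntry Z h w v j y ∧
      RowEntry Z h w v k z := by
  simp only [RowAvoids, not_not, sublist_map_sort_iff, rowEntry_iff]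
  constructor
  · rintro ⟨l, h1, h2, h3⟩
    match l, h3 with
    | [i, j, k], h3 =>
      simp only [List.map_cons, List.map_nil, List.cons.injEq, and_true] at h3
      simp only [List.pairwise_cons, List.mem_cons, List.not_mem_nil, or_false, forall_eq_or_imp,
        forall_eq] at h1
      exact ⟨i, j, k, h1.1.1, h1.2.1, ⟨h2 i (by simp), h3.1⟩, ⟨h2 j (by simp), h3.2.1⟩,
        ⟨h2 k (by simp), h3.2.2⟩⟩
  · rintro ⟨i, j, k, hij, hjk, h1, h2, h3⟩
    exact ⟨[i, j, k], by simp [hij, hjk, hij.trans hjk], by simp [h1.1, h2.1, h3.1],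
      by simp [h1.2, h2.2, h3.2]⟩

theorem not_rowAvoids_iff_quadruple {v : ℕ} {x y z t : Bool} :
    ¬ RowAvoids Z h [x, y, z, t] v w ↔ ∃ i j k l, i < j ∧ j < k ∧ k < l ∧
      RowEntry Z h w v i x ∧ RowEntry Z h w v j y ∧ RowEntry Z h w v k z ∧
        RowEntry Z h w v l t := by
  simp only [RowAvoids, not_not, sublist_map_sort_iff, rowEntry_iff]
  constructor
  · rintro ⟨l, h1, h2, h3⟩
    match l, h3 with
    | [i, j, k, l], h3 =>
      simp only [List.map_cons, List.map_nil, List.cons.injEq, and_true] at h3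
      simp only [List.pairwise_cons, List.mem_cons, List.not_mem_nil, or_false, forall_eq_or_imp,
        forall_eq] at h1
      exact ⟨i, j, k, l, h1.1.1, h1.2.1.1, h1.2.2.1, ⟨h2 i (by simp), h3.1⟩,
        ⟨h2 j (by simp), h3.2.1⟩, ⟨h2 k (by simp), h3.2.2.1⟩, ⟨h2 l (by simp), h3.2.2.2⟩⟩
  · rintro ⟨i, j, k, l, hij, hjk, hkl, h1, h2, h3, h4⟩
    exact ⟨[i, j, k, l], by simp [hij, hjk, hkl, hij.trans hjk, hjk.trans hkl,
      (hij.trans hjk).trans hkl], by simp [h1.1, h2.1, h3.1, h4.1],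
      by simp [h1.2, h2.2, h3.2, h4.2]⟩

end

/-- The zone of all columns. -/
def fullZone (n : ℕ) : ZoneRule n where
  zone _ := Set.univ
  mono _ _ _ := subset_rfl
  mem_of_eq _ _ _ _ _ _ _ := Set.mem_univ _

/-- The zone of the columns to the right of a filled one. -/
def rightZone (n : ℕ) : ZoneRule n where
  zone p := {i | ∃ j < i, 0 < p j}
  mono p p' hp := by
    rintro i ⟨j, hj, h⟩
    exact ⟨j, hj, by rwa [hp j h.ne']⟩
  mem_of_eq p p' q' i := by
    rintro ⟨j, hj, h⟩ hi hoff
    refine ⟨j, hj, ?_⟩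
    rwa [← hoff j]
    -- The zone is closed to the right: were `j` in it, so would be `i`.
    rintro ⟨k, hk, h'⟩
    exact hi ⟨k, hk.trans hj, h'⟩

/-- The zone of the columns to the left of a filled one. -/
def leftZone (n : ℕ) : ZoneRule n where
  zone p := {i | ∃ j > i, 0 < p j}
  mono p p' hp := by
    rintro i ⟨j, hj, h⟩
    exact ⟨j, hj, by rwa [hp j h.ne']⟩
  mem_of_eq p p' q' i := by
    rintro ⟨j, hj, h⟩ hi hoff
    refine ⟨j, hj, ?_⟩
    rwa [← hoff j]
    rintro ⟨k, hk, h'⟩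
    exact hi ⟨k, lt_trans hj hk, h'⟩

/-- The zone of the columns to the right of two filled ones whose entries are related by `Q`. -/
def pairZone (n : ℕ) (Q : ℕ → ℕ → Prop) : ZoneRule n where
  zone p := {i | ∃ j k, j < k ∧ k < i ∧ 0 < p j ∧ 0 < p k ∧ Q (p j) (p k)}
  mono p p' hp := by
    rintro i ⟨j, k, hj, hk, h1, h2, h3⟩
    refine ⟨j, k, hj, hk, ?_⟩
    rw [hp j h1.ne', hp k h2.ne']
    exact ⟨h1, h2, h3⟩
  mem_of_eq p p' q' i := by
    rintro ⟨j, k, hj, hk, h1, h2, h3⟩ hi hoff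
    -- The zone is closed to the right and misses `i`, so it misses every column before `i`.
    have aux : ∀ l < i, p' l = q' l := by
      intro l hl
      refine hoff l ?_
      rintro ⟨j', k', hj', hk', h'⟩
      exact hi ⟨j', k', hj', hk'.trans hl, h'⟩
    refine ⟨j, k, hj, hk, ?_⟩
    rw [← aux j (hj.trans hk), ← aux k hk]
    exact ⟨h1, h2, h3⟩

section

variable {n v : ℕ} {h w : Fin n → ℕ} {i : Fin n} {x : Bool}

theorem rowEntry_fullZone_iff : RowEntry (fullZone n) h w v i x ↔
    v ≤ h i ∧ if x then w i = v else w i < v :=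
  and_iff_right (Set.mem_univ i)

theorem rowEntry_rightZone_iff : RowEntry (rightZone n) h w v i x ↔
    (∃ j < i, v < w j) ∧ v ≤ h i ∧ if x then w i = v else w i < v := by
  refine and_congr_left fun _ => ?_
  change (∃ j < i, 0 < above v w j) ↔ _
  simp only [above_pos_iff]

theorem rowEntry_leftZone_iff : RowEntry (leftZone n) h w v i x ↔
    (∃ j > i, v < w j) ∧ v ≤ h i ∧ if x then w i = v else w i < v := by
  refine and_congr_left fun _ => ?_
  change (∃ j > i, 0 < above v w j) ↔ _
  simp only [above_pos_iff]

theorem rowEntry_pairZone_iff {Q : ℕ → ℕ → Prop} : RowEntry (pairZone n Q) h w v i x ↔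
    (∃ j k, j < k ∧ k < i ∧ v < w j ∧ v < w k ∧ Q (w j) (w k)) ∧
      v ≤ h i ∧ if x then w i = v else w i < v := by
  refine and_congr_left fun _ => ?_
  change (∃ j k, j < k ∧ k < i ∧ 0 < above v w j ∧ 0 < above v w k ∧
    Q (above v w j) (above v w k)) ↔ _
  simp only [above_pos_iff]
  refine exists_congr fun j => exists_congr fun k => and_congr_right fun _ =>
    and_congr_right fun _ => and_congr_right fun h1 => and_congr_right fun h2 => ?_
  rw [above_of_lt h1, above_of_lt h2]

end

/-- Containment of `π` in an inversion sequence is detected by the word `b` in some row. -/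
def RowDetects (π : Fin 4 → ℤ) (Z : ∀ n, ZoneRule n) (b : List Bool) : Prop :=
  ∀ (n : ℕ) (e : Fin n → ℕ), (∀ i, e i ≤ i) → (ContainsPattern e π ↔
    ∃ v < n, ¬ RowAvoids (Z n) (fun i => i + 1) b (v + 1) fun i => e i + 1)

/-- Entries are raised by 1 because 0 is reserved for unfilled columns; column `i`, counted from 0,
then has the rows `1, …, i + 1`. -/
theorem RowDetects.wilfEquivalent {π σ : Fin 4 → ℤ} {Z : ∀ n, ZoneRule n} {b b' : List Bool}
    (hπ : RowDetects π Z b) (hσ : RowDetects σ Z b') (hb : b.Perm b') : WilfEquivalent π σ := by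
  have key {π : Fin 4 → ℤ} {b : List Bool} (hπ : RowDetects π Z b) (n : ℕ) :
      (avoidanceClass n π).ncard = (rowAvoiders (Z n) (fun i : Fin n => i + 1) b n).ncard := by
    rw [← Set.ncard_image_of_injective (f := fun (e : Fin n → ℕ) i => e i + 1) (avoidanceClass n π)
      fun e e' h => funext fun i => Nat.succ_injective (congrFun h i)]
    congr 1
    have rows (w : Fin n → ℕ) :
        (∀ u, 1 ≤ u → u ≤ n → RowAvoids (Z n) (fun i : Fin n => i + 1) b u w) ↔
          ¬ ∃ v < n, ¬ RowAvoids (Z n) (fun i => i + 1) b (v + 1) w := by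
      push Not
      refine ⟨fun H v hv => H _ (by omega) (by omega), fun H u h1 h2 => ?_⟩
      have := H (u - 1) (by omega)
      rwa [Nat.sub_add_cancel h1] at this
    ext w
    constructor
    · rintro ⟨e, ⟨he, hc⟩, rfl⟩
      refine ⟨fun i => he i, fun i hi => absurd hi (Nat.succ_ne_zero _), ?_⟩
      rw [rows, ← hπ n e fun i => Nat.lt_succ_iff.1 (he i)]
      exact hc
    · rintro ⟨h1, h2, h3⟩
      have h0 (i) : w i - 1 + 1 = w i :=
        Nat.sub_add_cancel (Nat.one_le_iff_ne_zero.2 fun h => Nat.succ_ne_zero _ (h2 i h))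
      have hw : (fun i => w i - 1 + 1) = w := funext h0
      refine ⟨fun i => w i - 1, ⟨fun i => ?_, ?_⟩, hw⟩
      · have : w i ≤ i + 1 := h1 i
        have := h0 i
        change w i - 1 < i + 1
        omega
      · rw [hπ n _ fun i => ?_, hw, ← rows]
        · exact h3
        · have : w i ≤ i + 1 := h1 i
          have := h0 i
          omega
  intro n _
  rw [key hπ, key hσ]
  exact ncard_rowAvoiders_eq hb fun i => i.2

/-- The heights of the columns outside of a set `C`, for the positive entries of an inversion
sequence with zeros in `C`. -/
def heightOff {n : ℕ} (C : Finset (Fin n)) (i : Fin n) : ℕ := if i ∈ C then 0 else i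

/-- Containment of `π` in an inversion sequence is detected by the word `b` in some row of its
positive entries. -/
def PositiveRowDetects (π : Fin 4 → ℤ) (Z : ∀ n, ZoneRule n) (b : List Bool) : Prop :=
  ∀ (n : ℕ) (e : Fin n → ℕ), (∀ i, e i ≤ i) → (ContainsPattern e π ↔ ∃ v, 1 ≤ v ∧ v ≤ n ∧
    ¬ RowAvoids (Z n) (heightOff (Finset.univ.filter fun i => e i = 0)) b v e)

/-- The sequences are sorted by their set `C` of zeros. For fixed `C` the zeros are columns of
height 0, which meet no row, and the sequence itself is the filling. If `C` misses position 0, both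
fibres are empty. -/
theorem PositiveRowDetects.wilfEquivalent {π σ : Fin 4 → ℤ} {Z : ∀ n, ZoneRule n}
    {b b' : List Bool} (hπ : PositiveRowDetects π Z b) (hσ : PositiveRowDetects σ Z b')
    (hb : b.Perm b') : WilfEquivalent π σ := by
  have key {π : Fin 4 → ℤ} {b : List Bool} (hπ : PositiveRowDetects π Z b) {n : ℕ}
      (C : Finset (Fin n)) (hC : ∀ i : Fin n, (i : ℕ) = 0 → i ∈ C) :
      {e ∈ avoidanceClass n π | Finset.univ.filter (fun i => e i = 0) = C} =
        rowAvoiders (Z n) (heightOff C) b n := by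
    ext e
    have hzero (h1 : ∀ i, e i ≤ heightOff C i) (h2 : ∀ i, e i = 0 → heightOff C i = 0) :
        Finset.univ.filter (fun i => e i = 0) = C := by
      ext i
      have h1 := h1 i
      have h2 := h2 i
      have h3 := hC i
      simp only [heightOff, Finset.mem_filter, Finset.mem_univ, true_and] at h1 h2 ⊢
      by_cases hi : i ∈ C
      · simpa [hi] using h1
      · simp only [hi, if_false, iff_false] at h1 h2 h3 ⊢
        exact fun h => h3 (h2 h)
    constructor
    · rintro ⟨⟨he, hc⟩, rfl⟩
      have he' (i) : e i ≤ i := Nat.lt_succ_iff.1 (he i)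
      rw [hπ n e he'] at hc
      push Not at hc
      refine ⟨fun i => ?_, fun i hi => ?_, hc⟩
      · simp only [heightOff, Finset.mem_filter, Finset.mem_univ, true_and]
        split_ifs with h
        · exact h.le
        · exact he' i
      · simp [heightOff, hi]
    · rintro ⟨h1, h2, h3⟩
      have hz := hzero h1 h2
      have he' (i) : e i ≤ i := (h1 i).trans (by
        simp only [heightOff]
        split_ifs <;> omega)
      refine ⟨⟨fun i => Nat.lt_succ_iff.2 (he' i), ?_⟩, hz⟩
      rw [hπ n e he', hz]
      push Not
      exact h3
  intro n _
  have fib (π : Fin 4 → ℤ) : (avoidanceClass n π).ncard = ∑ C : Finset (Fin n),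
      {e ∈ avoidanceClass n π | Finset.univ.filter (fun i => e i = 0) = C}.ncard := by
    rw [Set.ncard_eq_toFinset_card _ (avoidanceClass_finite n π),
      Finset.card_eq_sum_card_fiberwise
        (f := fun e : Fin n → ℕ => Finset.univ.filter fun i => e i = 0) (t := Finset.univ)
        (fun _ _ => by simp)]
    refine Finset.sum_congr rfl fun C _ => ?_
    rw [← Set.ncard_coe_finset]
    congr 1
    ext e
    simp
  rw [fib, fib]
  refine Finset.sum_congr rfl fun C _ => ?_
  by_cases hC : ∀ i : Fin n, (i : ℕ) = 0 → i ∈ C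
  · rw [key hπ C hC, key hσ C hC]
    refine ncard_rowAvoiders_eq hb fun i => ?_
    simp only [heightOff]
    split_ifs <;> omega
  · have empty (π : Fin 4 → ℤ) :
        {e ∈ avoidanceClass n π | Finset.univ.filter (fun i => e i = 0) = C} = ∅ := by
      rw [Set.eq_empty_iff_forall_notMem]
      rintro e ⟨⟨he, -⟩, rfl⟩
      refine hC fun i hi => ?_
      have := he i
      simp only [Finset.mem_filter, Finset.mem_univ, true_and]
      omega
    rw [empty, empty]

/-! ### The zone and the word that detect each pattern -/

/-- The point to check is that the column of the letter 0 reaches the row: it lies to the right of a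
column with an entry there, and heights increase. -/
theorem rowDetects_1011 : RowDetects ![1, 0, 1, 1] fullZone [true, false, true, true] := by
  intro n e he
  rw [containsPattern_iff]
  simp only [not_rowAvoids_iff_quadruple, rowEntry_fullZone_iff]
  constructor
  · rintro ⟨i, j, k, l, hij, hjk, hkl, H⟩
    simp only [Matrix.cons_val] at H
    norm_num at H
    have := he i
    exact ⟨e i, by omega, i, j, k, l, hij, hjk, hkl, by grind⟩
  · rintro ⟨v, hv, i, j, k, l, hij, hjk, hkl, H⟩
    refine ⟨i, j, k, l, hij, hjk, hkl, ?_⟩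
    simp only [Matrix.cons_val]
    norm_num
    grind

theorem rowDetects_1101 : RowDetects ![1, 1, 0, 1] fullZone [true, true, false, true] := by
  intro n e he
  rw [containsPattern_iff]
  simp only [not_rowAvoids_iff_quadruple, rowEntry_fullZone_iff]
  constructor
  · rintro ⟨i, j, k, l, hij, hjk, hkl, H⟩
    simp only [Matrix.cons_val] at H
    norm_num at H
    have := he i
    exact ⟨e i, by omega, i, j, k, l, hij, hjk, hkl, by grind⟩
  · rintro ⟨v, hv, i, j, k, l, hij, hjk, hkl, H⟩
    refine ⟨i, j, k, l, hij, hjk, hkl, ?_⟩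
    simp only [Matrix.cons_val]
    norm_num
    grind

theorem rowDetects_1110 : RowDetects ![1, 1, 1, 0] fullZone [true, true, true, false] := by
  intro n e he
  rw [containsPattern_iff]
  simp only [not_rowAvoids_iff_quadruple, rowEntry_fullZone_iff]
  constructor
  · rintro ⟨i, j, k, l, hij, hjk, hkl, H⟩
    simp only [Matrix.cons_val] at H
    norm_num at H
    have := he i
    exact ⟨e i, by omega, i, j, k, l, hij, hjk, hkl, by grind⟩
  · rintro ⟨v, hv, i, j, k, l, hij, hjk, hkl, H⟩
    refine ⟨i, j, k, l, hij, hjk, hkl, ?_⟩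
    simp only [Matrix.cons_val]
    norm_num
    grind

/-- The letter 2 puts the other three columns into the zone. They lie to the right of an entry above
the row, so all of them reach the row, whatever the order of the letters 1, 1, 0. -/
theorem rowDetects_2110 : RowDetects ![2, 1, 1, 0] rightZone [true, true, false] := by
  intro n e he
  rw [containsPattern_iff]
  simp only [not_rowAvoids_iff_triple, rowEntry_rightZone_iff]
  constructor
  · rintro ⟨i, j, k, l, hij, hjk, hkl, H⟩
    simp only [Matrix.cons_val] at H
    norm_num at H
    have := he j
    have := he i
    exact ⟨e j, by omega, j, k, l, hjk, hkl, by grind⟩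
  · rintro ⟨v, hv, j, k, l, hjk, hkl, H⟩
    obtain ⟨i, hij, hi⟩ := H.1.1
    refine ⟨i, j, k, l, hij, hjk, hkl, ?_⟩
    simp only [Matrix.cons_val]
    norm_num
    grind

theorem rowDetects_2101 : RowDetects ![2, 1, 0, 1] rightZone [true, false, true] := by
  intro n e he
  rw [containsPattern_iff]
  simp only [not_rowAvoids_iff_triple, rowEntry_rightZone_iff]
  constructor
  · rintro ⟨i, j, k, l, hij, hjk, hkl, H⟩
    simp only [Matrix.cons_val] at H
    norm_num at H
    have := he j
    have := he i
    exact ⟨e j, by omega, j, k, l, hjk, hkl, by grind⟩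
  · rintro ⟨v, hv, j, k, l, hjk, hkl, H⟩
    obtain ⟨i, hij, hi⟩ := H.1.1
    refine ⟨i, j, k, l, hij, hjk, hkl, ?_⟩
    simp only [Matrix.cons_val]
    norm_num
    grind

theorem rowDetects_2011 : RowDetects ![2, 0, 1, 1] rightZone [false, true, true] := by
  intro n e he
  rw [containsPattern_iff]
  simp only [not_rowAvoids_iff_triple, rowEntry_rightZone_iff]
  constructor
  · rintro ⟨i, j, k, l, hij, hjk, hkl, H⟩
    simp only [Matrix.cons_val] at H
    norm_num at H
    have := he k
    have := he i
    exact ⟨e k, by omega, j, k, l, hjk, hkl, by grind⟩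
  · rintro ⟨v, hv, j, k, l, hjk, hkl, H⟩
    obtain ⟨i, hij, hi⟩ := H.1.1
    refine ⟨i, j, k, l, hij, hjk, hkl, ?_⟩
    simp only [Matrix.cons_val]
    norm_num
    grind

/-- A column to the left of a larger entry need not reach the row; here the letter 0 does because a
letter 1 precedes it. -/
theorem rowDetects_1102 : RowDetects ![1, 1, 0, 2] leftZone [true, true, false] := by
  intro n e he
  rw [containsPattern_iff]
  simp only [not_rowAvoids_iff_triple, rowEntry_leftZone_iff]
  constructor
  · rintro ⟨i, j, k, l, hij, hjk, hkl, H⟩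
    simp only [Matrix.cons_val] at H
    norm_num at H
    have := he i
    exact ⟨e i, by omega, i, j, k, hij, hjk, by grind⟩
  · rintro ⟨v, hv, i, j, k, hij, hjk, H⟩
    obtain ⟨l, hkl, hl⟩ := H.2.2.1
    refine ⟨i, j, k, l, hij, hjk, hkl, ?_⟩
    simp only [Matrix.cons_val]
    norm_num
    grind

theorem rowDetects_1012 : RowDetects ![1, 0, 1, 2] leftZone [true, false, true] := by
  intro n e he
  rw [containsPattern_iff]
  simp only [not_rowAvoids_iff_triple, rowEntry_leftZone_iff]
  constructor
  · rintro ⟨i, j, k, l, hij, hjk, hkl, H⟩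
    simp only [Matrix.cons_val] at H
    norm_num at H
    have := he i
    exact ⟨e i, by omega, i, j, k, hij, hjk, by grind⟩
  · rintro ⟨v, hv, i, j, k, hij, hjk, H⟩
    obtain ⟨l, hkl, hl⟩ := H.2.2.1
    refine ⟨i, j, k, l, hij, hjk, hkl, ?_⟩
    simp only [Matrix.cons_val]
    norm_num
    grind

/-- The two large letters only serve to open the zone, and `Q` records their relation; the row is
that of the letter 1. -/
theorem rowDetects_2201 : RowDetects ![2, 2, 0, 1] (pairZone · (· = ·)) [false, true] := by
  intro n e he
  rw [containsPattern_iff]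
  simp only [not_rowAvoids_iff_pair, rowEntry_pairZone_iff]
  constructor
  · rintro ⟨i, j, k, l, hij, hjk, hkl, H⟩
    simp only [Matrix.cons_val] at H
    norm_num at H
    have := he l
    have := he i
    exact ⟨e l, by omega, k, l, hkl, by grind⟩
  · rintro ⟨v, hv, k, l, hkl, H⟩
    obtain ⟨i, j, hij, hjk, hi⟩ := H.1.1
    refine ⟨i, j, k, l, hij, hjk, hkl, ?_⟩
    simp only [Matrix.cons_val]
    norm_num
    grind

theorem rowDetects_2210 : RowDetects ![2, 2, 1, 0] (pairZone · (· = ·)) [true, false] := by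
  intro n e he
  rw [containsPattern_iff]
  simp only [not_rowAvoids_iff_pair, rowEntry_pairZone_iff]
  constructor
  · rintro ⟨i, j, k, l, hij, hjk, hkl, H⟩
    simp only [Matrix.cons_val] at H
    norm_num at H
    have := he k
    have := he i
    exact ⟨e k, by omega, k, l, hkl, by grind⟩
  · rintro ⟨v, hv, k, l, hkl, H⟩
    obtain ⟨i, j, hij, hjk, hi⟩ := H.1.1
    refine ⟨i, j, k, l, hij, hjk, hkl, ?_⟩
    simp only [Matrix.cons_val]
    norm_num
    grind

theorem rowDetects_2301 : RowDetects ![2, 3, 0, 1] (pairZone · (· < ·)) [false, true] := by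
  intro n e he
  rw [containsPattern_iff]
  simp only [not_rowAvoids_iff_pair, rowEntry_pairZone_iff]
  constructor
  · rintro ⟨i, j, k, l, hij, hjk, hkl, H⟩
    simp only [Matrix.cons_val] at H
    norm_num at H
    have := he l
    have := he i
    exact ⟨e l, by omega, k, l, hkl, by grind⟩
  · rintro ⟨v, hv, k, l, hkl, H⟩
    obtain ⟨i, j, hij, hjk, hi⟩ := H.1.1
    refine ⟨i, j, k, l, hij, hjk, hkl, ?_⟩
    simp only [Matrix.cons_val]
    norm_num
    grind

theorem rowDetects_2310 : RowDetects ![2, 3, 1, 0] (pairZone · (· < ·)) [true, false] := by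
  intro n e he
  rw [containsPattern_iff]
  simp only [not_rowAvoids_iff_pair, rowEntry_pairZone_iff]
  constructor
  · rintro ⟨i, j, k, l, hij, hjk, hkl, H⟩
    simp only [Matrix.cons_val] at H
    norm_num at H
    have := he k
    have := he i
    exact ⟨e k, by omega, k, l, hkl, by grind⟩
  · rintro ⟨v, hv, k, l, hkl, H⟩
    obtain ⟨i, j, hij, hjk, hi⟩ := H.1.1
    refine ⟨i, j, k, l, hij, hjk, hkl, ?_⟩
    simp only [Matrix.cons_val]
    norm_num
    grind

theorem rowDetects_3201 : RowDetects ![3, 2, 0, 1] (pairZone · (· > ·)) [false, true] := by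
  intro n e he
  rw [containsPattern_iff]
  simp only [not_rowAvoids_iff_pair, rowEntry_pairZone_iff]
  constructor
  · rintro ⟨i, j, k, l, hij, hjk, hkl, H⟩
    simp only [Matrix.cons_val] at H
    norm_num at H
    have := he l
    have := he i
    exact ⟨e l, by omega, k, l, hkl, by grind⟩
  · rintro ⟨v, hv, k, l, hkl, H⟩
    obtain ⟨i, j, hij, hjk, hi⟩ := H.1.1
    refine ⟨i, j, k, l, hij, hjk, hkl, ?_⟩
    simp only [Matrix.cons_val]
    norm_num
    grind

theorem rowDetects_3210 : RowDetects ![3, 2, 1, 0] (pairZone · (· > ·)) [true, false] := by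
  intro n e he
  rw [containsPattern_iff]
  simp only [not_rowAvoids_iff_pair, rowEntry_pairZone_iff]
  constructor
  · rintro ⟨i, j, k, l, hij, hjk, hkl, H⟩
    simp only [Matrix.cons_val] at H
    norm_num at H
    have := he k
    have := he i
    exact ⟨e k, by omega, k, l, hkl, by grind⟩
  · rintro ⟨v, hv, k, l, hkl, H⟩
    obtain ⟨i, j, hij, hjk, hi⟩ := H.1.1
    refine ⟨i, j, k, l, hij, hjk, hkl, ?_⟩
    simp only [Matrix.cons_val]
    norm_num
    grind

/-- The letters other than 0 are positive entries, and conversely any occurrence of 221 among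
positive entries extends by the 0 in position 0. The height 0 of the zero columns prevents a zero
from acting as the letter 1. -/
theorem positiveRowDetects_0221 : PositiveRowDetects ![0, 2, 2, 1] fullZone [true, true, false] := by
  intro n e he
  rw [containsPattern_iff]
  simp only [not_rowAvoids_iff_triple, rowEntry_fullZone_iff, heightOff, Finset.mem_filter,
    Finset.mem_univ, true_and]
  constructor
  · rintro ⟨i, j, k, l, hij, hjk, hkl, H⟩
    simp only [Matrix.cons_val] at H
    norm_num at H
    have := he j
    exact ⟨e j, by grind, by omega, j, k, l, hjk, hkl, by grind⟩
  · rintro ⟨v, hv, hv', j, k, l, hjk, hkl, H⟩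
    have := he ⟨0, by omega⟩
    have hj : e j ≠ 0 := by grind
    have := he j
    refine ⟨⟨0, by omega⟩, j, k, l, Fin.lt_def.2 (by dsimp only; omega), hjk, hkl, ?_⟩
    simp only [Matrix.cons_val]
    norm_num
    grind

theorem positiveRowDetects_0212 : PositiveRowDetects ![0, 2, 1, 2] fullZone [true, false, true] := by
  intro n e he
  rw [containsPattern_iff]
  simp only [not_rowAvoids_iff_triple, rowEntry_fullZone_iff, heightOff, Finset.mem_filter,
    Finset.mem_univ, true_and]
  constructor
  · rintro ⟨i, j, k, l, hij, hjk, hkl, H⟩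
    simp only [Matrix.cons_val] at H
    norm_num at H
    have := he j
    exact ⟨e j, by grind, by omega, j, k, l, hjk, hkl, by grind⟩
  · rintro ⟨v, hv, hv', j, k, l, hjk, hkl, H⟩
    have := he ⟨0, by omega⟩
    have hj : e j ≠ 0 := by grind
    have := he j
    refine ⟨⟨0, by omega⟩, j, k, l, Fin.lt_def.2 (by dsimp only; omega), hjk, hkl, ?_⟩
    simp only [Matrix.cons_val]
    norm_num
    grind

theorem positiveRowDetects_0312 : PositiveRowDetects ![0, 3, 1, 2] rightZone [false, true] := by
  intro n e he
  rw [containsPattern_iff]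
  simp only [not_rowAvoids_iff_pair, rowEntry_rightZone_iff, heightOff, Finset.mem_filter,
    Finset.mem_univ, true_and]
  constructor
  · rintro ⟨i, j, k, l, hij, hjk, hkl, H⟩
    simp only [Matrix.cons_val] at H
    norm_num at H
    have := he l
    exact ⟨e l, by grind, by omega, k, l, hkl, by grind⟩
  · rintro ⟨v, hv, hv', k, l, hkl, H⟩
    obtain ⟨j, hjk, hj⟩ := H.1.1
    have := he ⟨0, by omega⟩
    have := he j
    -- Position 0 carries the entry 0 and precedes `j`, whose entry is positive.
    refine ⟨⟨0, by omega⟩, j, k, l, Fin.lt_def.2 (by dsimp only; omega), hjk, hkl, ?_⟩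
    simp only [Matrix.cons_val]
    norm_num
    grind

theorem positiveRowDetects_0321 : PositiveRowDetects ![0, 3, 2, 1] rightZone [true, false] := by
  intro n e he
  rw [containsPattern_iff]
  simp only [not_rowAvoids_iff_pair, rowEntry_rightZone_iff, heightOff, Finset.mem_filter,
    Finset.mem_univ, true_and]
  constructor
  · rintro ⟨i, j, k, l, hij, hjk, hkl, H⟩
    simp only [Matrix.cons_val] at H
    norm_num at H
    have := he k
    exact ⟨e k, by grind, by omega, k, l, hkl, by grind⟩
  · rintro ⟨v, hv, hv', k, l, hkl, H⟩
    obtain ⟨j, hjk, hj⟩ := H.1.1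
    have := he ⟨0, by omega⟩
    have := he j
    refine ⟨⟨0, by omega⟩, j, k, l, Fin.lt_def.2 (by dsimp only; omega), hjk, hkl, ?_⟩
    simp only [Matrix.cons_val]
    norm_num
    grind

theorem mainTheorem1 :
    -- the Wilf equivalences
    ((WilfEquivalent ![1, 0, 1, 1] ![1, 1, 0, 1] ∧ WilfEquivalent ![1, 1, 0, 1] ![1, 1, 1, 0]) ∧
      (WilfEquivalent ![2, 1, 1, 0] ![2, 1, 0, 1] ∧ WilfEquivalent ![2, 1, 0, 1] ![2, 0, 1, 1]) ∧
      WilfEquivalent ![0, 2, 2, 1] ![0, 2, 1, 2] ∧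
      WilfEquivalent ![0, 3, 1, 2] ![0, 3, 2, 1] ∧
      WilfEquivalent ![1, 1, 0, 2] ![1, 0, 1, 2] ∧
      WilfEquivalent ![2, 2, 0, 1] ![2, 2, 1, 0] ∧
      WilfEquivalent ![2, 3, 0, 1] ![2, 3, 1, 0] ∧
      WilfEquivalent ![3, 2, 0, 1] ![3, 2, 1, 0]) ∧
    -- there are no others, except that 3012 may belong to the last class
    (∀ π σ : Fin 4 → ℤ, WilfEquivalent π σ →
      OrderIsomorphic π σ ∨
      ∃ C ∈ ([{![1, 0, 1, 1], ![1, 1, 0, 1], ![1, 1, 1, 0]},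
              {![2, 1, 1, 0], ![2, 1, 0, 1], ![2, 0, 1, 1]},
              {![0, 2, 2, 1], ![0, 2, 1, 2]},
              {![0, 3, 1, 2], ![0, 3, 2, 1]},
              {![1, 1, 0, 2], ![1, 0, 1, 2]},
              {![2, 2, 0, 1], ![2, 2, 1, 0]},
              {![2, 3, 0, 1], ![2, 3, 1, 0]},
              {![3, 2, 0, 1], ![3, 2, 1, 0], ![3, 0, 1, 2]}] : List (Set (Fin 4 → ℤ))),
        (∃ π' ∈ C, OrderIsomorphic π π') ∧ (∃ σ' ∈ C, OrderIsomorphic σ σ')) := by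
  refine ⟨⟨⟨rowDetects_1011.wilfEquivalent rowDetects_1101 (by decide),
      rowDetects_1101.wilfEquivalent rowDetects_1110 (by decide)⟩,
    ⟨rowDetects_2110.wilfEquivalent rowDetects_2101 (by decide),
      rowDetects_2101.wilfEquivalent rowDetects_2011 (by decide)⟩,
    positiveRowDetects_0221.wilfEquivalent positiveRowDetects_0212 (by decide),
    positiveRowDetects_0312.wilfEquivalent positiveRowDetects_0321 (by decide),
    rowDetects_1102.wilfEquivalent rowDetects_1012 (by decide),
    rowDetects_2201.wilfEquivalent rowDetects_2210 (by decide),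
    rowDetects_2301.wilfEquivalent rowDetects_2310 (by decide),
    rowDetects_3201.wilfEquivalent rowDetects_3210 (by decide)⟩, fun π σ hπσ => ?_⟩
  refine hπσ.orderIsomorphic_or.imp_right ?_
  rintro ⟨C, hC, hπ, hσ⟩
  refine ⟨{x | ∃ p ∈ C, x = p.seq}, ?_, ?_, ?_⟩
  · have key : ∀ C ∈ patternClasses, {x | ∃ p ∈ C, x = p.seq} ∈
        patternClasses.map fun C => {x : Fin 4 → ℤ | ∃ p ∈ C, x = p.seq} :=
      fun C hC => List.mem_map_of_mem hC
    convert key C hC using 1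
    simp only [patternClasses, List.map_cons, List.map_nil, List.mem_cons, List.not_mem_nil,
      or_false, exists_eq_or_imp, exists_eq_left, Pattern.seq, Nat.cast_ofNat, Nat.cast_one,
      Nat.cast_zero]
    rfl
  · obtain ⟨p, hp, h⟩ := hπ
    exact ⟨_, ⟨p, hp, rfl⟩, h⟩
  · obtain ⟨p, hp, h⟩ := hσ
    exact ⟨_, ⟨p, hp, rfl⟩, h⟩
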